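/- Let $M$ be a smooth $n$-dimensional manifold, $0<T\le\infty$, let $g(t)$, $t\in[0,T)$, be a smooth family of Riemannian metrics on $M$ and $f:M\times[0,T)\to\mathbb R$ a smooth function solving the modified Ricci flow $$\frac{\partial}{\partial t}g_{ij}=-2R_{ij}+2\nabla_i\nabla_jf .$$ Here $\nabla$ is the Levi-Civita connection of $g(t)$ with Christoffel symbols $\Gamma_{ij}^k$; indices are raised with $g^{-1}$, repeated indices are summed, and $$R_{ijk}^l=\partial_i\Gamma_{jk}^l-\partial_j\Gamma_{ik}^l+\Gamma_{jk}^m\Gamma_{im}^l-\Gamma_{ik}^m\Gamma_{jm}^l,\qquad R_{jk}=R_{pjk}^p,\qquad R=g^{ij}R_{ij},\qquad P_{ijk}=\nabla_iR_{jk}-\nabla_jR_{ik}.$$ The symbol $\frac{\partial}{\partial t}R_i^l$ is the time derivative of the components $R_i^l=g^{lm}R_{im}$, $\nabla_i\nabla^l R$ is the $(1,1)$-Hessian of the scalar curvature, and $\Delta=g^{pq}\nabla_p\nabla_q$. Fix $\tau\in[0,T)$. On $\tilde M_\tau=M\times[0,T-\tau)$, with coordinates $x^0=t$ and local coordinates $x^1,\dots,x^n$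 on $M$, let $\tilde\nabla_\tau$ be the connection whose Christoffel symbols at $(x,t)$ are $$\tilde\Gamma_{ij}^k=\Gamma_{ij}^k\quad(1\le i,j,k\le n),\tag{D1}$$ $$\tilde\Gamma_{ij}^0=0\quad(0\le i,j\le n),\tag{D2}$$ $$\tilde\Gamma_{i0}^k=\tilde\Gamma_{0i}^k=-R_i^k+\nabla_i\nabla^kf\quad(1\le i,k\le n),\tag{D3}$$ $$\tilde\Gamma_{00}^k=\nabla^k\left(-\tfrac12R+\tfrac{\partial f}{\partial t}-\tfrac12|\nabla f|^2\right)\quad(1\le k\le n),\tag{D4}$$ with right-hand sides evaluated at $(x,t+\tau)$, and let $$\tilde R_{ijk}^l=\partial_i\tilde\Gamma_{jk}^l-\partial_j\tilde\Gamma_{ik}^l+\sum_{m=0}^n\left(\tilde\Gamma_{jk}^m\tilde\Gamma_{im}^l-\tilde\Gamma_{ik}^m\tilde\Gamma_{jm}^l\right),\qquad 0\le i,j,k,l\le n,$$ be the components of its curvature tensor. **Theorem 3.1.** In every local coordinate system on $M$, and for all indices $1\le i,j,k,l\le n$, $$\tilde R_{ijk}^l=R_{ijk}^l,\tag{E1}$$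 $$\tilde R_{ijk}^0=0,\tag{E2}$$ $$\tilde R_{ij0}^l=-\nabla_iR_j^l+\nabla_jR_i^l+R_{ijp}^l\nabla^pf,\tag{E3}$$ $$\tilde R_{i0k}^l=-\nabla^lR_{ik}+\nabla_kR_i^l+R_{ipk}^l\nabla^pf,\tag{E3'}$$ $$\begin{aligned}\tilde R_{i00}^l&=\frac{\partial}{\partial t}R_i^l-\nabla^pf\,\nabla_pR_i^l-\tfrac12\nabla_i\nabla^lR-R_i^pR_p^l-\{\nabla_iR_p^l-\nabla_pR_i^l\}\nabla^pf\\&\quad-\{\nabla^lR_{ip}-\nabla_pR_i^l\}\nabla^pf+R_i^p\nabla_p\nabla^lf-R_p^l\nabla_i\nabla^pf+R_{ipq}^l\nabla^pf\,\nabla^qf\\&=\Delta R_i^l-\tfrac12\nabla_i\nabla^lR+2g^{lm}R_{pim}^qR_q^p-R_i^mR_m^l-g^{ql}P_{ipq}\nabla^pf\\&\quad-g^{ql}P_{qpi}\nabla^pf+R_{ipq}^l\nabla^pf\,\nabla^qf,\end{aligned}\tag{E4}$$ where the left-hand sides are evaluated at $(x,t)\in\tilde M_\tau$ and the right-hand sides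 at $(x,t+\tau)$. -/

import Mathlib

open scoped Manifold ContDiff

noncomputable section

namespace SpacetimeRicci

/-- A function of the local coordinates `x = (x¹, …, xⁿ)` and of the time `t`. -/
abbrev LocalFun (n : ℕ) : Type := EuclideanSpace ℝ (Fin n) × ℝ → ℝ

/-- The time interval `[0, T)`, where `T = ∞` is allowed. -/
def timeInterval (T : EReal) : Set ℝ := {t | 0 ≤ t ∧ (t : EReal) < T}

/-- The partial derivative `∂F/∂xⁱ` (at fixed time). -/
def dx {n : ℕ} (i : Fin n) (F : LocalFun n) : LocalFun n :=
  fun p => fderiv ℝ (fun v => F (v, p.2)) p.1 (EuclideanSpace.single i 1)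

/-- The time derivative `∂F/∂t` of a function defined for times in `S`; it is one-sided at an
endpoint of `S`. -/
def dt {n : ℕ} (S : Set ℝ) (F : LocalFun n) : LocalFun n :=
  fun p => derivWithin (fun s => F (p.1, s)) S p.2

/-- The curvature `R_{ijk}^l = ∂_i Γ_{jk}^l - ∂_j Γ_{ik}^l + Γ_{jk}^m Γ_{im}^l - Γ_{ik}^m Γ_{jm}^l`
of a connection with Christoffel symbols `Γ i j k = Γ_{ij}^k`, where `D i = ∂_i`. -/
def curvature {ι X : Type*} [Fintype ι] (D : ι → (X → ℝ) → X → ℝ) (Γ : ι → ι → ι → X → ℝ)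
    (i j k l : ι) : X → ℝ :=
  fun p => D i (Γ j k l) p - D j (Γ i k l) p
    + ∑ m, Γ j k m p * Γ i m l p - ∑ m, Γ i k m p * Γ j m l p

section TimeDependentMetric

/- `G i j` are the components `g_{ij}(x, t)` of a time-dependent metric in local coordinates. -/
variable {n : ℕ} (G : Fin n → Fin n → LocalFun n)

/-- The inverse metric `g^{ij}`. -/
def ginv (i j : Fin n) : LocalFun n :=
  fun p => ((Matrix.of fun a b => G a b p)⁻¹ : Matrix (Fin n) (Fin n) ℝ) i j

/-- The Christoffel symbols `Γ_{ij}^k` of the Levi-Civita connection. -/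
def christoffel (i j k : Fin n) : LocalFun n :=
  fun p => (1 / 2 : ℝ) *
    ∑ l, ginv G k l p * (dx i (G j l) p + dx j (G i l) p - dx l (G i j) p)

/-- The Riemann curvature tensor `R_{ijk}^l`. -/
def riem (i j k l : Fin n) : LocalFun n := curvature dx (christoffel G) i j k l

/-- The Ricci tensor `R_{jk} = R_{pjk}^p`. -/
def ric (j k : Fin n) : LocalFun n := fun p => ∑ a, riem G a j k a p

/-- The Ricci tensor with one index raised, `R_i^l = g^{lm} R_{im}`. -/
def ricUp (i l : Fin n) : LocalFun n := fun p => ∑ m, ginv G l m p * ric G i m p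

/-- The scalar curvature `R = g^{ij} R_{ij}`. -/
def scal : LocalFun n := fun p => ∑ i, ∑ j, ginv G i j p * ric G i j p

/-- The covariant derivative `∇_i V^k` of a vector field `V k = V^k`. -/
def covVec (V : Fin n → LocalFun n) (i k : Fin n) : LocalFun n :=
  fun p => dx i (V k) p + ∑ m, christoffel G i m k p * V m p

/-- The covariant derivative `∇_i α_j` of a 1-form `α j = α_j`. -/
def covForm (α : Fin n → LocalFun n) (i j : Fin n) : LocalFun n :=
  fun p => dx i (α j) p - ∑ m, christoffel G i j m p * α m p

/-- The covariant derivative `∇_i A_{jk}` of a tensor `A j k = A_{jk}`. -/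
def covTwo (A : Fin n → Fin n → LocalFun n) (i j k : Fin n) : LocalFun n :=
  fun p => dx i (A j k) p
    - ∑ m, christoffel G i j m p * A m k p - ∑ m, christoffel G i k m p * A j m p

/-- The covariant derivative `∇_i A_j^l` of a tensor `A j l = A_j^l`. -/
def covMixed (A : Fin n → Fin n → LocalFun n) (i j l : Fin n) : LocalFun n :=
  fun p => dx i (A j l) p
    - ∑ m, christoffel G i j m p * A m l p + ∑ m, christoffel G i m l p * A j m p

/-- The covariant derivative `∇_h B_{ij}^l` of a tensor `B i j l = B_{ij}^l`. -/
def covMixedTwo (B : Fin n → Fin n → Fin n → LocalFun n) (h i j l : Fin n) : LocalFun n :=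
  fun p => dx h (B i j l) p
    - ∑ m, christoffel G h i m p * B m j l p - ∑ m, christoffel G h j m p * B i m l p
    + ∑ m, christoffel G h m l p * B i j m p

/-- The (rough) Laplacian `Δ A_i^l = g^{pq} ∇_p ∇_q A_i^l`. -/
def laplacianMixed (A : Fin n → Fin n → LocalFun n) (i l : Fin n) : LocalFun n :=
  fun p => ∑ a, ∑ b, ginv G a b p * covMixedTwo G (covMixed G A) a b i l p

/-- The gradient `∇^k h = g^{km} ∂_m h`. -/
def grad (h : LocalFun n) (k : Fin n) : LocalFun n := fun p => ∑ m, ginv G k m p * dx m h p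

/-- The Hessian `∇_i ∇_j h`. -/
def hess (h : LocalFun n) (i j : Fin n) : LocalFun n := covForm G (fun m => dx m h) i j

/-- The Hessian with one index raised, `∇_i ∇^k h`. -/
def hessUp (h : LocalFun n) (i k : Fin n) : LocalFun n := covVec G (grad G h) i k

/-- `|∇h|² = g^{kl} ∂_k h ∂_l h`. -/
def gradSq (h : LocalFun n) : LocalFun n := fun p => ∑ k, grad G h k p * dx k h p

/-- `∇_i R_{jk}`. -/
def dRic (i j k : Fin n) : LocalFun n := covTwo G (ric G) i j k

/-- `∇_i R_j^l`. -/
def dRicUp (i j l : Fin n) : LocalFun n := covMixed G (ricUp G) i j l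

/-- `∇^l R_{ik} = g^{lm} ∇_m R_{ik}`. -/
def dUpRic (l i k : Fin n) : LocalFun n := fun p => ∑ m, ginv G l m p * dRic G m i k p

/-- The tensor `P_{ijk} = ∇_i R_{jk} - ∇_j R_{ik}`. -/
def tensorP (i j k : Fin n) : LocalFun n := fun p => dRic G i j k p - dRic G j i k p

/-- The Christoffel symbols `Γ̃_{ij}^k(x, t)` of the space-time connection `∇̃_τ` on
`M × [0, T - τ)`, in the coordinates `x⁰ = t, x¹, …, xⁿ`. The index `0 : Fin (n + 1)` is the time
index and `i.succ` is the space index `i`; `F` is the potential `f` in the coordinates. -/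
def stGamma (T : EReal) (τ : ℝ) (F : LocalFun n) (i j k : Fin (n + 1)) : LocalFun n :=
  fun p =>
    -- the right hand sides are evaluated at `(x, t + τ)`
    let q : EuclideanSpace ℝ (Fin n) × ℝ := (p.1, p.2 + τ)
    Fin.cases (motive := fun _ => ℝ)
      -- `Γ̃_{ij}^0 = 0`
      0
      (fun c => Fin.cases (motive := fun _ => ℝ)
        (Fin.cases (motive := fun _ => ℝ)
          -- `Γ̃_{00}^c = ∇^c (- R / 2 + ∂f/∂t - |∇f|² / 2)`
          (grad G (fun r => -(1 / 2 : ℝ) * scal G r + dt (timeInterval T) F r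
            - (1 / 2 : ℝ) * gradSq G F r) c q)
          -- `Γ̃_{0b}^c = - R_b^c + ∇_b ∇^c f`
          (fun b => -ricUp G b c q + hessUp G F b c q) j)
        (fun a => Fin.cases (motive := fun _ => ℝ)
          -- `Γ̃_{a0}^c = - R_a^c + ∇_a ∇^c f`
          (-ricUp G a c q + hessUp G F a c q)
          -- `Γ̃_{ab}^c = Γ_{ab}^c`
          (fun b => christoffel G a b c q) j) i) k

end TimeDependentMetric

/-- The partial derivatives in space-time `M × S`: `∂_0 = ∂/∂t` and `∂_{i.succ} = ∂/∂xⁱ`. -/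
def stD {n : ℕ} (S : Set ℝ) (i : Fin (n + 1)) (F : LocalFun n) : LocalFun n :=
  Fin.cases (motive := fun _ => LocalFun n) (dt S F) (fun a => dx a F) i

/-- The curvature `R̃_{ijk}^l` of `∇̃_τ` on `M × [0, T - τ)`. -/
def stRiem {n : ℕ} (T : EReal) (τ : ℝ) (G : Fin n → Fin n → LocalFun n) (F : LocalFun n)
    (i j k l : Fin (n + 1)) : LocalFun n :=
  curvature (stD (timeInterval (T - (τ : EReal)))) (stGamma G T τ F) i j k l

/-- The components `g_{ij}(x, t) = g(t)(∂_i, ∂_j)` in the coordinate chart `φ` of a family of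
Riemannian metrics `g(t)` on `M`. -/
def metricComp {n : ℕ} {M : Type*} [TopologicalSpace M]
    [ChartedSpace (EuclideanSpace ℝ (Fin n)) M]
    (g : ℝ → Bundle.RiemannianMetric (fun x : M => TangentSpace (𝓡 n) x))
    (φ : OpenPartialHomeomorph M (EuclideanSpace ℝ (Fin n))) (i j : Fin n) : LocalFun n :=
  fun p => (g p.2).inner (φ.symm p.1)
    (mfderiv (𝓡 n) (𝓡 n) φ.symm p.1 (EuclideanSpace.single i (1 : ℝ)))
    (mfderiv (𝓡 n) (𝓡 n) φ.symm p.1 (EuclideanSpace.single j (1 : ℝ)))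

/-- The function `f(x, t)` in the coordinate chart `φ`. -/
def funComp {n : ℕ} {M : Type*} [TopologicalSpace M] (f : M × ℝ → ℝ)
    (φ : OpenPartialHomeomorph M (EuclideanSpace ℝ (Fin n))) :
    LocalFun n :=
  fun p => f (φ.symm p.1, p.2)

/-- `(M, g(t))`, `t ∈ [0, T)`, with the potential `f : M × [0, T) → ℝ` is a smooth solution to the
modified Ricci flow `∂g_{ij}/∂t = -2 R_{ij} + 2 ∇_i ∇_j f`. Only times in `[0, T)` matter. -/
structure IsModifiedRicciFlow {n : ℕ} {M : Type*} [TopologicalSpace M]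
    [ChartedSpace (EuclideanSpace ℝ (Fin n)) M]
    (T : EReal) (g : ℝ → Bundle.RiemannianMetric (fun x : M => TangentSpace (𝓡 n) x))
    (f : M × ℝ → ℝ) : Prop where
  /-- In every smooth chart of `M`, the components `g_{ij}(x, t)` are smooth in `(x, t)`. -/
  smooth_metric : ∀ φ ∈ IsManifold.maximalAtlas (𝓡 n) ∞ M, ∀ i j : Fin n,
    ContDiffOn ℝ ∞ (metricComp g φ i j) (φ.target ×ˢ timeInterval T)
  /-- `f` is smooth on `M × [0, T)`. -/
  smooth_potential : ContMDiffOn ((𝓡 n).prod 𝓘(ℝ, ℝ)) 𝓘(ℝ, ℝ) ∞ f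
    (Set.univ ×ˢ timeInterval T)
  /-- The evolution equation, in every smooth chart of `M`. -/
  flow : ∀ φ ∈ IsManifold.maximalAtlas (𝓡 n) ∞ M, ∀ u ∈ φ.target, ∀ t ∈ timeInterval T,
    ∀ i j : Fin n,
      dt (timeInterval T) (metricComp g φ i j) (u, t)
        = -2 * ric (metricComp g φ) i j (u, t)
          + 2 * hess (metricComp g φ) (funComp f φ) i j (u, t)

end SpacetimeRicci

end

noncomputable section

namespace SpacetimeRicci

open Finset

/-! ### Matrix-valued connections and their Bianchi identity -/

section Gauge

variable {ι A : Type*} [CommRing A] [Algebra ℝ A]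

/-! Every identity in the theorem is a formal consequence of the Leibniz rule, of commuting
derivatives, of the invertibility of g and of the flow equation. The tensor calculus is therefore
done in a commutative ℝ-algebra with commuting derivations (`MetricAlgebra`, `FlowAlgebra`), where
no differentiability has to be tracked. Only at the end is the algebra taken to be the smooth
functions on U × [0, T), and `Represents` translates each coordinate expression into an element of
it.

The flow says ∂_t g = 2v with v = -Ric + Hess f, and v with an index raised is Γ̃_{i0}. Since
Γ̃_{ij}^0 = 0, the time index never contributes to the quadratic terms of the curvature. The purely
spatial components are then immediate. In R̃_{ij0}^l the Hessian part of v gives a commutator of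
covariant derivatives of ∇f, hence a curvature term (`spaceCurv_eq`). In R̃_{i0k}^l the formula for
∂_t Γ leaves an antisymmetrised derivative of v, and the third derivatives of f in it again collapse
to a curvature term (`mixedCurv_eq`).

For R̃_{i00}^l the potential -R/2 + ∂_t f - |∇f|²/2 is such that ∂_t(Hess f), the third derivatives
of f and the squares of Hess f all cancel (`timeCurv_eq`). The second expression also needs the
evolution of Ric. Here v and the matrices Γ_i are treated as one matrix-valued connection in the
directions t, x¹, …, xⁿ; its Bianchi identity gives ∂_t Riem in terms of ∇R̃_{i0k}^l (`Dt_riem`).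
Tracing with the contracted Bianchi identities gives ∂_t Ric (`Dt_ric`), and raising an index gives
`Dt_ricUp`. -/

theorem map_derivation_add (d : Derivation ℝ A A) (M N : Matrix ι ι A) :
    (M + N).map d = M.map d + N.map d := by
  ext; simp

theorem map_derivation_sub (d : Derivation ℝ A A) (M N : Matrix ι ι A) :
    (M - N).map d = M.map d - N.map d := by
  ext; simp

variable [Fintype ι]

theorem map_derivation_mul (d : Derivation ℝ A A) (M N : Matrix ι ι A) :
    (M * N).map d = M.map d * N + M * N.map d := by
  ext i j
  simp only [Matrix.map_apply, Matrix.mul_apply, Matrix.add_apply, map_sum, Derivation.leibniz,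
    smul_eq_mul, ← sum_add_distrib]
  exact sum_congr rfl fun _ _ => by ring

/-- The curvature of the matrix-valued connection with components `M` and `N` in the directions
of the derivations `d` and `e`. -/
def gaugeCurv (d e : Derivation ℝ A A) (M N : Matrix ι ι A) : Matrix ι ι A :=
  N.map d - M.map e + N * M - M * N

/-- The Bianchi identity for matrix-valued connections. -/
theorem gauge_bianchi {d₁ d₂ d₃ : Derivation ℝ A A}
    (h₁₂ : ∀ a, d₁ (d₂ a) = d₂ (d₁ a)) (h₁₃ : ∀ a, d₁ (d₃ a) = d₃ (d₁ a))
    (h₂₃ : ∀ a, d₂ (d₃ a) = d₃ (d₂ a)) (M₁ M₂ M₃ : Matrix ι ι A) :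
    ((gaugeCurv d₂ d₃ M₂ M₃).map d₁ - M₁ * gaugeCurv d₂ d₃ M₂ M₃ + gaugeCurv d₂ d₃ M₂ M₃ * M₁)
      + ((gaugeCurv d₃ d₁ M₃ M₁).map d₂ - M₂ * gaugeCurv d₃ d₁ M₃ M₁
        + gaugeCurv d₃ d₁ M₃ M₁ * M₂)
      + ((gaugeCurv d₁ d₂ M₁ M₂).map d₃ - M₃ * gaugeCurv d₁ d₂ M₁ M₂
        + gaugeCurv d₁ d₂ M₁ M₂ * M₃) = 0 := by
  have c {d e : Derivation ℝ A A} (h : ∀ a, d (e a) = e (d a)) (M : Matrix ι ι A) :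
      (M.map e).map d = (M.map d).map e := by ext; simp [h]
  simp only [gaugeCurv, map_derivation_add, map_derivation_sub, map_derivation_mul, c h₁₂, c h₁₃,
    c h₂₃]
  noncomm_ring

end Gauge

/-- A metric `g` with inverse `gi` over a commutative algebra with commuting derivations `D i`. -/
structure MetricAlgebra (ι A : Type*) [Fintype ι] [DecidableEq ι] [CommRing A] [Algebra ℝ A] where
  /-- The coordinate derivations. -/
  D : ι → Derivation ℝ A A
  /-- The metric. -/
  g : ι → ι → A
  /-- The inverse metric. -/
  gi : ι → ι → A
  D_comm : ∀ i j a, D i (D j a) = D j (D i a)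
  g_symm : ∀ i j, g i j = g j i
  gi_symm : ∀ i j, gi i j = gi j i
  gi_mul_g : ∀ i j, ∑ k, gi i k * g k j = if i = j then 1 else 0

/-! ### Levi-Civita calculus over the algebra -/

namespace MetricAlgebra

variable {ι A : Type*} [Fintype ι] [DecidableEq ι] [CommRing A] [Algebra ℝ A]
  (K : MetricAlgebra ι A)

/-- The element `1 / 2`. -/
def half (A : Type*) [CommRing A] [Algebra ℝ A] : A := algebraMap ℝ A (1 / 2)

theorem two_mul_half : 2 * half A = 1 := by
  rw [half, ← map_ofNat (algebraMap ℝ A) 2, ← map_mul]; norm_num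

theorem derivation_half (d : Derivation ℝ A A) : d (half A) = 0 := d.map_algebraMap _

theorem derivation_half_mul (d : Derivation ℝ A A) (a : A) : d (half A * a) = half A * d a := by
  simp [derivation_half]

theorem derivation_two_mul (d : Derivation ℝ A A) (a : A) : d (2 * a) = 2 * d a := by
  simp only [two_mul, map_add]

/-- The Christoffel symbols. -/
def Γ (i j k : ι) : A :=
  half A * ∑ l, K.gi k l * (K.D i (K.g j l) + K.D j (K.g i l) - K.D l (K.g i j))

/-- The curvature tensor. -/
def riem (i j k l : ι) : A :=
  K.D i (K.Γ j k l) - K.D j (K.Γ i k l)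
    + ∑ m, K.Γ j k m * K.Γ i m l - ∑ m, K.Γ i k m * K.Γ j m l

/-- The Ricci tensor. -/
def ric (j k : ι) : A := ∑ a, K.riem a j k a

/-- The Ricci tensor with an index raised. -/
def ricUp (i l : ι) : A := ∑ m, K.gi l m * K.ric i m

/-- The scalar curvature. -/
def scal : A := ∑ i, ∑ j, K.gi i j * K.ric i j

/-- The covariant derivative of a vector field. -/
def covVec (V : ι → A) (i k : ι) : A := K.D i (V k) + ∑ m, K.Γ i m k * V m

/-- The covariant derivative of a 1-form. -/
def covForm (α : ι → A) (i j : ι) : A := K.D i (α j) - ∑ m, K.Γ i j m * α m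

/-- The covariant derivative of a tensor `B_{jk}`. -/
def covTwo (B : ι → ι → A) (i j k : ι) : A :=
  K.D i (B j k) - ∑ m, K.Γ i j m * B m k - ∑ m, K.Γ i k m * B j m

/-- The covariant derivative of a tensor `B_{ijk}`. -/
def covThree (B : ι → ι → ι → A) (h i j k : ι) : A :=
  K.D h (B i j k) - ∑ m, K.Γ h i m * B m j k - ∑ m, K.Γ h j m * B i m k
    - ∑ m, K.Γ h k m * B i j m

/-- The covariant derivative of a tensor `B_j^l`. -/
def covMixed (B : ι → ι → A) (i j l : ι) : A :=
  K.D i (B j l) - ∑ m, K.Γ i j m * B m l + ∑ m, K.Γ i m l * B j m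

/-- The covariant derivative of a tensor `B_{ij}^l`. -/
def covMixedTwo (B : ι → ι → ι → A) (h i j l : ι) : A :=
  K.D h (B i j l) - ∑ m, K.Γ h i m * B m j l - ∑ m, K.Γ h j m * B i m l
    + ∑ m, K.Γ h m l * B i j m

/-- The covariant derivative of a tensor `B_{ijk}^l`. -/
def covMixedThree (B : ι → ι → ι → ι → A) (h i j k l : ι) : A :=
  K.D h (B i j k l) - ∑ m, K.Γ h i m * B m j k l - ∑ m, K.Γ h j m * B i m k l
    - ∑ m, K.Γ h k m * B i j m l + ∑ m, K.Γ h m l * B i j k m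

/-- The gradient of a function. -/
def grad (f : A) (k : ι) : A := ∑ m, K.gi k m * K.D m f

/-- The Hessian of a function. -/
def hess (f : A) (i j : ι) : A := K.covForm (fun m => K.D m f) i j

/-- The Hessian of a function with an index raised. -/
def hessUp (f : A) (i k : ι) : A := K.covVec (K.grad f) i k

/-! ### Symmetry and compatibility with the metric -/

theorem Γ_symm (i j k : ι) : K.Γ i j k = K.Γ j i k := by
  simp only [Γ, K.g_symm i j]
  congr 1
  exact sum_congr rfl fun _ _ => by ring

theorem sum_g_gi (i j : ι) : ∑ k, K.g i k * K.gi k j = if i = j then 1 else 0 := by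
  simp only [eq_comm (a := i), ← K.gi_mul_g j i]
  exact sum_congr rfl fun k _ => by rw [K.g_symm i k, K.gi_symm k j]; ring

theorem sum_gi_sum_g (v : ι → A) (i : ι) : ∑ k, K.gi i k * ∑ l, K.g k l * v l = v i := by
  simp only [mul_sum, ← mul_assoc]
  rw [sum_comm]
  simp [← sum_mul, K.gi_mul_g]

theorem sum_g_sum_gi (v : ι → A) (i : ι) : ∑ k, K.g i k * ∑ l, K.gi k l * v l = v i := by
  simp only [mul_sum, ← mul_assoc]
  rw [sum_comm]
  simp [← sum_mul, K.sum_g_gi]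

/-- Lowering an index is injective because g is invertible, so formulas involving g⁻¹ can be checked
in lowered form. -/
theorem eq_of_sum_g_eq {v w : ι → A} (h : ∀ i, ∑ k, K.g i k * v k = ∑ k, K.g i k * w k) (i : ι) :
    v i = w i := by
  rw [← K.sum_gi_sum_g v, ← K.sum_gi_sum_g w]
  simp only [h]

theorem sum_g_Γ (i j k : ι) : ∑ m, K.g k m * K.Γ i j m
    = half A * (K.D i (K.g j k) + K.D j (K.g i k) - K.D k (K.g i j)) := by
  rw [← K.sum_g_sum_gi (fun k => half A * (K.D i (K.g j k) + K.D j (K.g i k) - K.D k (K.g i j))) k]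
  refine sum_congr rfl fun m _ => ?_
  rw [Γ, mul_sum]
  congr 1
  exact sum_congr rfl fun _ _ => by ring

/-- Metric compatibility, ∇g = 0: in the sum of two lowered Koszul formulas everything cancels
except two halves of ∂_i g_{jk}. -/
theorem D_g (i j k : ι) :
    K.D i (K.g j k) = ∑ m, K.g k m * K.Γ i j m + ∑ m, K.g j m * K.Γ i k m := by
  rw [sum_g_Γ, sum_g_Γ, K.g_symm k j, K.g_symm i j]
  linear_combination (- K.D i (K.g j k)) * two_mul_half (A := A)

/-- The derivative of the inverse matrix, in terms of that of the matrix. -/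
theorem derivation_gi (d : Derivation ℝ A A) (i j : ι) :
    d (K.gi i j) = -∑ k, ∑ l, K.gi i k * (K.gi j l * d (K.g k l)) := by
  refine K.eq_of_sum_g_eq (v := fun i => d (K.gi i j))
    (w := fun i => -∑ k, ∑ l, K.gi i k * (K.gi j l * d (K.g k l))) (fun i => ?_) i
  have h := congrArg d (K.sum_g_gi i j)
  have h0 : d (if i = j then 1 else 0) = 0 := by split <;> simp
  simp only [h0, map_sum, Derivation.leibniz, smul_eq_mul, sum_add_distrib] at h
  rw [eq_neg_of_add_eq_zero_left h]
  simp only [mul_neg, sum_neg_distrib, ← mul_sum]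
  rw [K.sum_g_sum_gi (fun k => ∑ l, K.gi j l * d (K.g k l)) i]
  congr 1
  exact sum_congr rfl fun k _ => by rw [K.gi_symm k j]

/-- This is ∇g⁻¹ = 0, obtained by inserting ∇g = 0 into the formula for the derivative of an inverse
matrix. -/
theorem D_gi (i j k : ι) :
    K.D i (K.gi j k) = -∑ m, K.Γ i m j * K.gi m k - ∑ m, K.Γ i m k * K.gi j m := by
  rw [derivation_gi]
  have h₁ : ∑ a, ∑ b, K.gi j a * (K.gi k b * ∑ m, K.g b m * K.Γ i a m)
      = ∑ m, K.Γ i m k * K.gi j m := by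
    refine sum_congr rfl fun a _ => ?_
    rw [← mul_sum, K.sum_gi_sum_g (K.Γ i a), mul_comm]
  have h₂ : ∑ a, ∑ b, K.gi j a * (K.gi k b * ∑ m, K.g a m * K.Γ i b m)
      = ∑ m, K.Γ i m j * K.gi m k := by
    rw [sum_comm]
    refine sum_congr rfl fun b _ => ?_
    simp only [mul_left_comm (K.gi j _) (K.gi k _)]
    rw [← mul_sum, K.sum_gi_sum_g (K.Γ i b), K.gi_symm k b, mul_comm]
  simp only [D_g, mul_add, sum_add_distrib]
  rw [h₁, h₂]
  ring

end MetricAlgebra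

/-! ### Rearrangement of iterated sums -/

section Sums

variable {ι A : Type*} [Fintype ι] [CommRing A]

theorem sum_mul_sum_comm (a b : ι → A) (c : ι → ι → A) :
    ∑ m, a m * ∑ k, b k * c m k = ∑ k, b k * ∑ m, a m * c m k := by
  simp only [mul_sum]
  rw [sum_comm]
  exact sum_congr rfl fun _ _ => sum_congr rfl fun _ _ => by ring

theorem sum_sum_mul (a : ι → A) (b : ι → ι → A) (c : ι → A) :
    ∑ k, (∑ m, a m * b m k) * c k = ∑ m, a m * ∑ k, b m k * c k := by
  simp only [mul_sum, sum_mul]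
  rw [sum_comm]
  exact sum_congr rfl fun _ _ => sum_congr rfl fun _ _ => by ring

theorem sum_mul_sum_transpose (a v : ι → A) (b : ι → ι → A) :
    ∑ k, a k * ∑ m, b m k * v m = ∑ k, (∑ m, b k m * a m) * v k := by
  simp only [mul_sum, sum_mul]
  rw [sum_comm]
  exact sum_congr rfl fun _ _ => sum_congr rfl fun _ _ => by ring

theorem sum_sum_mul_mul (a : ι → ι → A) (v b : ι → A) :
    ∑ m, (∑ p, a m p * v p) * b m = ∑ p, (∑ m, a m p * b m) * v p := by
  simp only [sum_mul]
  rw [sum_comm]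
  exact sum_congr rfl fun _ _ => sum_congr rfl fun _ _ => by ring

theorem derivation_sum_mul [Algebra ℝ A] (d : Derivation ℝ A A) (a b : ι → A) :
    d (∑ m, a m * b m) = ∑ m, a m * d (b m) + ∑ m, d (a m) * b m := by
  simp only [map_sum, Derivation.leibniz, smul_eq_mul, sum_add_distrib, mul_comm (b _)]

end Sums

namespace MetricAlgebra

variable {ι A : Type*} [Fintype ι] [DecidableEq ι] [CommRing A] [Algebra ℝ A]
  (K : MetricAlgebra ι A)

/-! ### Raising indices and contractions commute with covariant derivatives -/

/-- Because ∇g⁻¹ = 0, the derivative of a raised component is the raised derivative up to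
Christoffel corrections; all the raising lemmas below rest on this. -/
theorem D_sum_gi (v : ι → A) (i l : ι) : K.D i (∑ m, K.gi l m * v m)
    = ∑ m, K.gi l m * K.D i (v m) - ∑ m, K.Γ i m l * ∑ k, K.gi m k * v k
      - ∑ m, K.gi l m * ∑ k, K.Γ i m k * v k := by
  simp only [derivation_sum_mul, D_gi, sub_mul, neg_mul, sum_sub_distrib, sum_neg_distrib,
    sum_sum_mul]
  simp only [mul_comm (K.Γ i _ _) (K.gi l _), sum_sum_mul]
  ring

theorem covVec_raise (α : ι → A) (i k : ι) :
    K.covVec (fun k => ∑ m, K.gi k m * α m) i k = ∑ m, K.gi k m * K.covForm α i m := by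
  simp only [covVec, covForm, D_sum_gi, mul_sub, sum_sub_distrib]
  ring

theorem covMixed_raise (B : ι → ι → A) (i j l : ι) :
    K.covMixed (fun j l => ∑ m, K.gi l m * B j m) i j l = ∑ m, K.gi l m * K.covTwo B i j m := by
  simp only [covMixed, covTwo, D_sum_gi, mul_sub, sum_sub_distrib,
    sum_mul_sum_comm (K.Γ i j)]
  ring

theorem covMixedTwo_raise (B : ι → ι → ι → A) (h i j l : ι) :
    K.covMixedTwo (fun i j l => ∑ m, K.gi l m * B i j m) h i j l
      = ∑ m, K.gi l m * K.covThree B h i j m := by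
  simp only [covMixedTwo, covThree, D_sum_gi, mul_sub, sum_sub_distrib,
    sum_mul_sum_comm (K.Γ h i), sum_mul_sum_comm (K.Γ h j)]
  ring

theorem sum_covMixed (B : ι → ι → A) (i : ι) :
    ∑ p, K.covMixed B i p p = K.D i (∑ p, B p p) := by
  simp only [covMixed, sum_add_distrib, sum_sub_distrib, map_sum]
  rw [sum_comm (f := fun p m => K.Γ i m p * B p m)]
  ring

theorem sum_covMixedTwo (B : ι → ι → ι → A) (h j : ι) :
    ∑ p, K.covMixedTwo B h p j p = K.covForm (fun j => ∑ p, B p j p) h j := by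
  simp only [covMixedTwo, covForm, sum_add_distrib, sum_sub_distrib, map_sum, mul_sum]
  rw [sum_comm (f := fun p m => K.Γ h m p * B p j m),
    sum_comm (f := fun p m => K.Γ h j m * B p m p)]
  ring

theorem sum_covMixedThree (B : ι → ι → ι → ι → A) (h j k : ι) :
    ∑ p, K.covMixedThree B h p j k p = K.covTwo (fun j k => ∑ p, B p j k p) h j k := by
  simp only [covMixedThree, covTwo, sum_add_distrib, sum_sub_distrib, map_sum, mul_sum]
  rw [sum_comm (f := fun p m => K.Γ h m p * B p j k m),
    sum_comm (f := fun p m => K.Γ h j m * B p m k p),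
    sum_comm (f := fun p m => K.Γ h k m * B p j m p)]
  ring

/-- A metric trace is raising an index followed by a contraction, and each of these commutes with ∇.
-/
theorem D_sum_sum_gi (B : ι → ι → A) (i : ι) : K.D i (∑ j, ∑ k, K.gi j k * B j k)
    = ∑ j, ∑ k, K.gi j k * K.covTwo B i j k := by
  simp only [← covMixed_raise, sum_covMixed]

theorem covMixedThree_contract (B : ι → ι → ι → ι → A) (h i l : ι) :
    K.covMixed (fun i l => ∑ j, ∑ k, K.gi j k * B i j k l) h i l
      = ∑ j, ∑ k, K.gi j k * K.covMixedThree B h i j k l := by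
  have := K.D_sum_sum_gi (fun j k => B i j k l) h
  simp only [covMixed, this, covTwo, covMixedThree, mul_add, mul_sub, sum_add_distrib,
    sum_sub_distrib]
  have e (b : ι → ι → ι → A) (a : ι → A) : ∑ m, a m * ∑ j, ∑ k, K.gi j k * b m j k
      = ∑ j, ∑ k, K.gi j k * ∑ m, a m * b m j k := by
    simp only [← sum_mul_sum_comm a]
    simp only [mul_sum]
    rw [sum_comm]
  rw [e, e]
  ring

/-! ### Product rules -/

theorem covMixedTwo_contract_vec (B : ι → ι → ι → ι → A) (V : ι → A) (h i j l : ι) :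
    K.covMixedTwo (fun i j l => ∑ q, B i q j l * V q) h i j l
      = ∑ q, K.covMixedThree B h i q j l * V q + ∑ q, B i q j l * K.covVec V h q := by
  simp only [covMixedTwo, derivation_sum_mul, covMixedThree, covVec, mul_add, sub_mul,
    add_mul, sum_add_distrib, sum_sub_distrib, sum_sum_mul (K.Γ h i), sum_sum_mul (K.Γ h j),
    sum_sum_mul (K.Γ h · l), sum_mul_sum_transpose]
  ring

theorem covForm_contract_vec (B : ι → ι → A) (V : ι → A) (h j : ι) :
    K.covForm (fun j => ∑ q, B q j * V q) h j
      = ∑ q, K.covTwo B h q j * V q + ∑ q, B q j * K.covVec V h q := by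
  simp only [covForm, derivation_sum_mul, covTwo, covVec, mul_add, sub_mul,
    sum_add_distrib, sum_sub_distrib, sum_sum_mul (K.Γ h j), sum_mul_sum_transpose]
  ring

/-! ### Ricci identities -/

/-- The left side is ∇_i∇_j V^l - ∇_j∇_i V^l: the omitted terms Γ_{ij}^m ∇_m V^l are symmetric in i
and j and drop out. -/
theorem ricci_identity_vec (V : ι → A) (i j l : ι) :
    K.D i (K.covVec V j l) - K.D j (K.covVec V i l) + ∑ m, K.covVec V j m * K.Γ i m l
      - ∑ m, K.covVec V i m * K.Γ j m l = ∑ p, K.riem i j p l * V p := by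
  simp only [covVec, map_add, derivation_sum_mul, K.D_comm i j, riem, add_mul, sub_mul,
    sum_add_distrib, sum_sub_distrib, sum_sum_mul_mul (fun m p => K.Γ j p m), sum_sum_mul_mul (fun m p => K.Γ i p m),
    mul_comm (K.D _ (V _))]
  ring

theorem ricci_identity_form (α : ι → A) (i j k : ι) :
    K.covTwo (K.covForm α) i j k - K.covTwo (K.covForm α) j i k
      = -∑ m, K.riem i j k m * α m := by
  simp only [covTwo, covForm, map_sub, derivation_sum_mul, K.D_comm i j, riem, add_mul, sub_mul,
    mul_sub, sum_add_distrib, sum_sub_distrib, sum_sum_mul, K.Γ_symm i j]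
  ring

theorem ricci_identity_mixed (B : ι → ι → A) (i j k l : ι) :
    K.covMixedTwo (K.covMixed B) i j k l - K.covMixedTwo (K.covMixed B) j i k l
      = ∑ m, K.riem i j m l * B k m - ∑ m, K.riem i j k m * B m l := by
  have e (a : ι → A) (b : ι → ι → A) :
      ∑ m, a m * ∑ p, b p m * B k p = ∑ p, (∑ m, b p m * a m) * B k p :=
    sum_mul_sum_transpose ..
  simp only [covMixedTwo, covMixed, map_add, map_sub, derivation_sum_mul, K.D_comm i j, riem,
    add_mul, sub_mul, mul_sub, mul_add, sum_add_distrib, sum_sub_distrib,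
    sum_sum_mul (K.Γ j k), sum_sum_mul (K.Γ i k), K.Γ_symm i j, e]
  rw [sum_mul_sum_comm (K.Γ i · l) (K.Γ j k), sum_mul_sum_comm (K.Γ j · l) (K.Γ i k)]
  ring

/-! ### Symmetries of the curvature tensor -/

/-- The Christoffel symbols `Γ_{ij}^k` as matrices with indices `j` and `k`. -/
def Γm (i : ι) : Matrix ι ι A := Matrix.of (K.Γ i)

theorem gaugeCurv_Γm (i j k l : ι) :
    gaugeCurv (K.D i) (K.D j) (K.Γm i) (K.Γm j) k l = K.riem i j k l := by
  simp [gaugeCurv, Γm, riem, Matrix.mul_apply]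

theorem riem_antisymm (i j k l : ι) : K.riem i j k l = -K.riem j i k l := by
  simp only [riem]; ring

theorem riem_first_bianchi (i j k l : ι) :
    K.riem i j k l + K.riem j k i l + K.riem k i j l = 0 := by
  simp only [riem, K.Γ_symm i k, K.Γ_symm j i, K.Γ_symm k j]; ring

theorem covMixedThree_riem_antisymm (h i j k l : ι) :
    K.covMixedThree K.riem h i j k l = -K.covMixedThree K.riem h j i k l := by
  simp only [covMixedThree, K.riem_antisymm i, map_neg, mul_neg, sum_neg_distrib,
    fun m => K.riem_antisymm m j]
  ring

/-- The matrix Bianchi identity already contains the Christoffel terms acting on k and l. Those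
acting on the form indices h, i, j cancel in the cyclic sum, as Γ is symmetric and the curvature
antisymmetric in its first two indices. -/
theorem riem_second_bianchi (h i j k l : ι) :
    K.covMixedThree K.riem h i j k l + K.covMixedThree K.riem i j h k l
      + K.covMixedThree K.riem j h i k l = 0 := by
  have e := congrFun (congrFun (gauge_bianchi (K.D_comm h i) (K.D_comm h j) (K.D_comm i j)
    (K.Γm h) (K.Γm i) (K.Γm j)) k) l
  simp only [Matrix.add_apply, Matrix.sub_apply, Matrix.mul_apply, Matrix.map_apply,
    gaugeCurv_Γm, Matrix.zero_apply] at e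
  have s (a b x : ι) : ∑ m, K.Γ a b m * K.riem m x k l = -∑ m, K.Γ a b m * K.riem x m k l := by
    simp only [K.riem_antisymm _ x, mul_neg, sum_neg_distrib]
  simp only [covMixedThree, s, K.Γ_symm i h, K.Γ_symm j h, K.Γ_symm j i]
  simp only [Γm, Matrix.of_apply, mul_comm (K.riem _ _ _ _)] at e
  linear_combination e

/-- The curvature tensor with all indices lowered. -/
def riemDown (i j k l : ι) : A := ∑ m, K.g l m * K.riem i j k m

theorem sum_gi_riemDown (i j k l : ι) :
    ∑ m, K.gi l m * K.riemDown i j k m = K.riem i j k l :=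
  K.sum_gi_sum_g _ _

theorem map_D_g (i : ι) : (Matrix.of K.g).map (K.D i)
    = K.Γm i * Matrix.of K.g + Matrix.of K.g * (K.Γm i).transpose := by
  ext j k
  simp only [Matrix.map_apply, Matrix.of_apply, D_g, Matrix.add_apply, Matrix.mul_apply, Γm,
    Matrix.transpose_apply]
  congr 1
  exact sum_congr rfl fun m _ => by rw [K.g_symm k m, mul_comm]

/-- Expanding ∂_i∂_j g = ∂_j∂_i g with ∂_i g = Γ_i g + g Γ_iᵀ gives F g + g Fᵀ = 0 for the curvature
matrix F. -/
theorem riemDown_antisymm (i j k l : ι) : K.riemDown i j k l = -K.riemDown i j l k := by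
  set g : Matrix ι ι A := Matrix.of K.g
  have hd (i j : ι) : (g.map (K.D j)).map (K.D i) =
      (K.Γm j).map (K.D i) * g + K.Γm j * (K.Γm i * g + g * (K.Γm i).transpose)
        + ((K.Γm i * g + g * (K.Γm i).transpose) * (K.Γm j).transpose
          + g * ((K.Γm j).map (K.D i)).transpose) := by
    rw [map_D_g, map_derivation_add, map_derivation_mul, map_derivation_mul, map_D_g]
    rfl
  have hc : (g.map (K.D j)).map (K.D i) = (g.map (K.D i)).map (K.D j) := by
    ext; simp [K.D_comm i j]
  rw [hd i j, hd j i] at hc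
  have e : gaugeCurv (K.D i) (K.D j) (K.Γm i) (K.Γm j) * g
      + g * (gaugeCurv (K.D i) (K.D j) (K.Γm i) (K.Γm j)).transpose = 0 := by
    rw [← sub_eq_zero] at hc
    rw [← hc]
    simp only [gaugeCurv, Matrix.transpose_add, Matrix.transpose_sub, Matrix.transpose_mul]
    noncomm_ring
  have := congrFun (congrFun e k) l
  simp only [Matrix.add_apply, Matrix.mul_apply, Matrix.transpose_apply, gaugeCurv_Γm, g,
    Matrix.of_apply, Matrix.zero_apply] at this
  rw [riemDown, riemDown, eq_neg_iff_add_eq_zero, ← this]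
  congr 1
  exact sum_congr rfl fun m _ => by rw [K.g_symm l m, mul_comm]

theorem riemDown_antisymm_left (i j k l : ι) : K.riemDown i j k l = -K.riemDown j i k l := by
  simp only [riemDown, K.riem_antisymm i j, mul_neg, sum_neg_distrib]

theorem riemDown_first_bianchi (i j k l : ι) :
    K.riemDown i j k l + K.riemDown j k i l + K.riemDown k i j l = 0 := by
  simp only [riemDown, ← sum_add_distrib, ← mul_add, riem_first_bianchi, mul_zero,
    sum_const_zero]

/-- The octahedron argument: four first Bianchi identities combine, by the two antisymmetries, to
twice the claim. -/
theorem riemDown_pair_symm (i j k l : ι) : K.riemDown i j k l = K.riemDown k l i j := by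
  have b₁ := K.riemDown_first_bianchi i j k l
  have b₂ := K.riemDown_first_bianchi j k l i
  have b₃ := K.riemDown_first_bianchi k l i j
  have b₄ := K.riemDown_first_bianchi l i j k
  have a₁ := K.riemDown_antisymm i j k l
  have a₂ := K.riemDown_antisymm j k i l
  have a₃ := K.riemDown_antisymm k l i j
  have a₄ := K.riemDown_antisymm l i j k
  have a₅ := K.riemDown_antisymm k i j l
  have a₆ := K.riemDown_antisymm l j k i
  have c₅ := K.riemDown_antisymm_left k i l j
  have c₆ := K.riemDown_antisymm_left l j k i
  have c₇ := K.riemDown_antisymm_left j l k i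
  have c₈ := K.riemDown_antisymm_left l j i k
  have h : 2 * (K.riemDown i j k l - K.riemDown k l i j) = 0 := by
    grind
  linear_combination half A * h - (K.riemDown i j k l - K.riemDown k l i j) * two_mul_half (A := A)

/-- Pair symmetry in a form with one index up, where the raised index changes places. -/
theorem sum_gi_riem (i k l p : ι) :
    ∑ m, K.gi l m * K.riem m k i p = -∑ q, K.gi p q * K.riem i q k l := by
  simp only [← K.sum_gi_riemDown]
  rw [sum_mul_sum_comm, ← sum_neg_distrib]
  simp only [← mul_neg, ← sum_neg_distrib]
  refine sum_congr rfl fun q _ => congrArg _ <| sum_congr rfl fun m _ => ?_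
  rw [K.riemDown_pair_symm, K.riemDown_antisymm]

theorem ric_symm (j k : ι) : K.ric j k = K.ric k j := by
  simp only [ric, ← K.sum_gi_riemDown]
  rw [sum_comm]
  refine sum_congr rfl fun a _ => sum_congr rfl fun m _ => ?_
  rw [K.gi_symm, K.riemDown_pair_symm, K.riemDown_antisymm, K.riemDown_antisymm_left, neg_neg]

/-- Writing R_i^l as a metric trace that leaves the upper index of the curvature free lets the
second contraction of the Bianchi identity be taken in `sum_covMixed_ricUp`. -/
theorem ricUp_eq (i l : ι) : K.ricUp i l = ∑ j, ∑ k, K.gi j k * K.riem i j k l := by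
  have h (m : ι) : K.ric i m = -∑ a, K.riem m a i a := by
    rw [ric_symm, ric, ← sum_neg_distrib]
    exact sum_congr rfl fun _ _ => K.riem_antisymm ..
  simp only [ricUp, h, mul_neg, sum_neg_distrib, mul_sum]
  rw [sum_comm]
  simp only [sum_gi_riem, sum_neg_distrib, neg_neg]
  rw [sum_comm]
  simp only [K.gi_symm]

/-! ### Contracted Bianchi identities -/

theorem sum_covMixedThree_riem (i j k : ι) : ∑ p, K.covMixedThree K.riem p i j k p
    = K.covTwo K.ric i j k - K.covTwo K.ric j i k := by
  have h : ∑ p, (K.covMixedThree K.riem p i j k p + K.covMixedThree K.riem i j p k p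
      + K.covMixedThree K.riem j p i k p) = 0 :=
    sum_eq_zero fun p _ => K.riem_second_bianchi ..
  simp only [sum_add_distrib, K.covMixedThree_riem_antisymm i j, sum_neg_distrib,
    sum_covMixedThree] at h
  change _ = K.covTwo (fun j k => ∑ p, K.riem p j k p) i j k
    - K.covTwo (fun j k => ∑ p, K.riem p j k p) j i k
  linear_combination h

/-- Tracing the contracted Bianchi identity once more gives div Ric = ∇R - div Ric. -/
theorem sum_covMixed_ricUp (i : ι) :
    ∑ p, K.covMixed K.ricUp p i p = half A * K.D i K.scal := by
  have h : ∑ j, ∑ k, K.gi j k * ∑ p, K.covMixedThree K.riem p i j k p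
      = ∑ p, K.covMixed K.ricUp p i p := by
    have (p : ι) : K.covMixed K.ricUp p i p
        = ∑ j, ∑ k, K.gi j k * K.covMixedThree K.riem p i j k p := by
      rw [← covMixedThree_contract]
      simp only [← ricUp_eq]
    simp only [this, mul_sum]
    exact (sum_congr rfl fun _ _ => sum_comm).trans sum_comm
  have h' : ∑ j, ∑ k, K.gi j k * K.covTwo K.ric j i k = ∑ j, K.covMixed K.ricUp j i j :=
    sum_congr rfl fun j _ => (K.covMixed_raise K.ric j i j).symm
  have h'' : ∑ j, ∑ k, K.gi j k * K.covTwo K.ric i j k = K.D i K.scal :=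
    (K.D_sum_sum_gi K.ric i).symm
  simp only [sum_covMixedThree_riem, mul_sub, sum_sub_distrib, h', h''] at h
  linear_combination -half A * h
    - (∑ p, K.covMixed K.ricUp p i p) * two_mul_half (A := A)

/-! ### Hessians -/

theorem hess_symm (f : A) (i j : ι) : K.hess f i j = K.hess f j i := by
  simp only [hess, covForm, K.D_comm i j, K.Γ_symm i j]

theorem hessUp_eq (f : A) (i k : ι) : K.hessUp f i k = ∑ m, K.gi k m * K.hess f i m :=
  K.covVec_raise (fun m => K.D m f) i k

theorem covTwo_symm (B : ι → ι → A) (hB : ∀ j k, B j k = B k j) (i j k : ι) :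
    K.covTwo B i j k = K.covTwo B i k j := by
  simp only [covTwo, hB _ k, hB j]
  ring

theorem covTwo_hess_sub (f : A) (i j k : ι) :
    K.covTwo (K.hess f) i j k - K.covTwo (K.hess f) j i k = -∑ m, K.riem i j k m * K.D m f :=
  K.ricci_identity_form (fun m => K.D m f) i j k

/-- Symmetry of the Hessian turns the difference into a commutator of covariant derivatives on df;
pair symmetry then moves the index contracted with ∇f. This is the origin of the term R_{ipk}^l ∇^p
f. -/
theorem sum_gi_covTwo_hess_sub (f : A) (i k l : ι) :
    ∑ m, K.gi l m * (K.covTwo (K.hess f) m i k - K.covTwo (K.hess f) k i m)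
      = ∑ p, K.riem i p k l * K.grad f p := by
  have h (m : ι) : K.covTwo (K.hess f) m i k - K.covTwo (K.hess f) k i m
      = -∑ p, K.D p f * K.riem m k i p := by
    rw [K.covTwo_symm _ (K.hess_symm f) m, K.covTwo_symm _ (K.hess_symm f) k, covTwo_hess_sub]
    simp only [mul_comm]
  simp only [h, mul_neg, sum_neg_distrib]
  rw [sum_mul_sum_comm]
  simp only [sum_gi_riem, mul_neg, sum_neg_distrib, neg_neg, grad]
  simp only [mul_sum]
  rw [sum_comm]
  exact sum_congr rfl fun _ _ => sum_congr rfl fun _ _ => by rw [K.gi_symm]; ring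

/-- The squared norm of the gradient. -/
def gradSq (f : A) : A := ∑ k, K.grad f k * K.D k f

theorem D_gradSq (f : A) (j : ι) : K.D j (K.gradSq f) = 2 * ∑ q, K.hess f q j * K.grad f q := by
  have h₁ : K.gradSq f = ∑ k, ∑ m, K.gi k m * (K.D k f * K.D m f) := by
    simp only [gradSq, grad, sum_mul]
    exact sum_congr rfl fun _ _ => sum_congr rfl fun _ _ => by ring
  have h₂ (k m : ι) : K.covTwo (fun k m => K.D k f * K.D m f) j k m
      = K.hess f k j * K.D m f + K.hess f m j * K.D k f := by
    rw [K.hess_symm f k, K.hess_symm f m]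
    simp only [covTwo, hess, covForm, Derivation.leibniz, smul_eq_mul, sub_mul, sum_mul]
    simp only [mul_left_comm _ (K.D k f), mul_comm _ (K.D k f), mul_assoc]
    ring
  have h₃ : ∑ k, ∑ m, K.gi k m * (K.hess f k j * K.D m f) = ∑ q, K.hess f q j * K.grad f q := by
    simp only [grad, mul_sum, mul_left_comm]
  have h₄ : ∑ k, ∑ m, K.gi k m * (K.hess f m j * K.D k f) = ∑ q, K.hess f q j * K.grad f q := by
    rw [← h₃, sum_comm]
    simp only [K.gi_symm]
  rw [h₁, D_sum_sum_gi]
  simp only [h₂, mul_add, sum_add_distrib, h₃, h₄]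
  ring

theorem covForm_two_mul (α : ι → A) (i j : ι) :
    K.covForm (fun j => 2 * α j) i j = 2 * K.covForm α i j := by
  simp only [covForm, two_mul, map_add, mul_add, sum_add_distrib]
  ring

theorem hessUp_gradSq (f : A) (i l : ι) : K.hessUp (K.gradSq f) i l
    = 2 * (∑ m, K.gi l m * ∑ q, K.covTwo (K.hess f) i q m * K.grad f q
      + ∑ q, K.hessUp f i q * K.hessUp f q l) := by
  have h (m : ι) : K.hess (K.gradSq f) i m = 2 * (∑ q, K.covTwo (K.hess f) i q m * K.grad f q
      + ∑ q, K.hessUp f i q * K.hess f q m) := by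
    have e := K.covForm_contract_vec (K.hess f) (K.grad f) i m
    simp only [mul_comm (K.hess f _ m) (K.covVec _ _ _)] at e
    simp only [hess, hessUp] at e ⊢
    rw [← e, ← covForm_two_mul]
    simp only [D_gradSq, hess]
  simp only [K.hessUp_eq _ i l, h, K.hessUp_eq f _ l]
  simp only [mul_add, mul_left_comm _ (2 : A), ← mul_sum, sum_add_distrib]
  rw [sum_mul_sum_comm (K.gi l) (K.hessUp f i)]

theorem grad_add (f h : A) (k : ι) : K.grad (f + h) k = K.grad f k + K.grad h k := by
  simp only [grad, map_add, mul_add, sum_add_distrib]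

theorem hessUp_add (f h : A) (i k : ι) : K.hessUp (f + h) i k = K.hessUp f i k + K.hessUp h i k := by
  simp only [hessUp, covVec, grad_add, map_add, mul_add, sum_add_distrib]
  ring

theorem hessUp_half_mul (f : A) (i k : ι) :
    K.hessUp (half A * f) i k = half A * K.hessUp f i k := by
  have (m : ι) : K.grad (half A * f) m = half A * K.grad f m := by
    simp only [grad, Derivation.leibniz, derivation_half, smul_eq_mul, mul_zero, add_zero, mul_sum]
    exact sum_congr rfl fun _ _ => by ring
  simp only [hessUp, covVec, this, Derivation.leibniz, derivation_half, smul_eq_mul, mul_zero,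
    add_zero, mul_left_comm _ (half A), ← mul_sum]
  ring

/-- Both sides are g^{lm} x_{mt} g^{ts} y_{is}. Only x need be symmetric, so y may be any tensor. -/
theorem sum_gi_sum_mul (x y : ι → ι → A) (hx : ∀ i j, x i j = x j i) (i l : ι) :
    ∑ m, K.gi l m * ∑ s, (∑ t, K.gi s t * x m t) * y i s
      = ∑ t, (∑ s, K.gi t s * y i s) * ∑ m, K.gi l m * x t m := by
  have h (m : ι) : ∑ s, (∑ t, K.gi s t * x m t) * y i s
      = ∑ t, (∑ s, K.gi t s * y i s) * x t m := by
    rw [sum_sum_mul_mul]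
    refine sum_congr rfl fun t _ => ?_
    rw [hx]
    exact congrArg (· * x t m) (sum_congr rfl fun s _ => by rw [K.gi_symm])
  simp only [h]
  exact sum_mul_sum_comm ..

end MetricAlgebra

/-- A solution of the modified Ricci flow over a commutative algebra; `Dt` is the derivation in
the direction of time. -/
structure FlowAlgebra (ι A : Type*) [Fintype ι] [DecidableEq ι] [CommRing A] [Algebra ℝ A]
    extends MetricAlgebra ι A where
  /-- The time derivation. -/
  Dt : Derivation ℝ A A
  /-- The potential. -/
  f : A
  Dt_comm : ∀ i a, Dt (D i a) = D i (Dt a)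
  flow : ∀ i j, Dt (g i j) = -2 * toMetricAlgebra.ric i j + 2 * toMetricAlgebra.hess f i j

/-! ### Evolution equations and the space-time curvature -/

namespace FlowAlgebra

open MetricAlgebra

variable {ι A : Type*} [Fintype ι] [DecidableEq ι] [CommRing A] [Algebra ℝ A]
  (K : FlowAlgebra ι A)

/-- The tensor `-R_{ij} + ∇_i ∇_j f`. -/
def vel (i j : ι) : A := -K.ric i j + K.hess K.f i j

/-- The tensor `-R_i^j + ∇_i ∇^j f`. -/
def velUp (i j : ι) : A := -K.ricUp i j + K.hessUp K.f i j

theorem vel_symm (i j : ι) : K.vel i j = K.vel j i := by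
  rw [vel, vel, K.ric_symm, K.hess_symm]

theorem velUp_eq (i l : ι) : K.velUp i l = ∑ m, K.gi l m * K.vel i m := by
  simp only [velUp, K.hessUp_eq, MetricAlgebra.ricUp, vel, mul_add, mul_neg, sum_add_distrib,
    sum_neg_distrib]

theorem Dt_g (i j : ι) : K.Dt (K.g i j) = 2 * K.vel i j := by
  rw [K.flow, vel]; ring

theorem Dt_gi (i j : ι) : K.Dt (K.gi i j) = -2 * ∑ k, K.gi i k * K.velUp k j := by
  rw [K.derivation_gi]
  simp only [Dt_g, velUp_eq, mul_left_comm _ (2 : A), ← mul_sum]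
  ring

/-- The time derivative of the lowered Koszul formula. The partial derivatives of v become covariant
ones, and the factor 1/2 is absorbed by ∂_t g = 2v. -/
theorem Dt_Γ (i j l : ι) : K.Dt (K.Γ i j l)
    = ∑ k, K.gi l k * (K.covTwo K.vel i j k + K.covTwo K.vel j i k - K.covTwo K.vel k i j) := by
  refine K.eq_of_sum_g_eq (v := fun l => K.Dt (K.Γ i j l)) (w := fun l => ∑ k, K.gi l k *
    (K.covTwo K.vel i j k + K.covTwo K.vel j i k - K.covTwo K.vel k i j)) (fun k => ?_) l
  rw [K.sum_g_sum_gi]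
  have h := congrArg K.Dt (K.sum_g_Γ i j k)
  simp only [derivation_sum_mul, derivation_half_mul, map_sub, map_add, K.Dt_comm, Dt_g,
    derivation_two_mul] at h
  rw [eq_sub_of_add_eq h]
  have e (a b c : ι) : ∑ m, K.Γ a b m * K.vel c m = ∑ m, K.Γ a b m * K.vel m c :=
    sum_congr rfl fun m _ => by rw [K.vel_symm]
  have e' : ∑ m, 2 * K.vel k m * K.Γ i j m = 2 * ∑ m, K.Γ i j m * K.vel m k := by
    simp only [mul_sum]
    exact sum_congr rfl fun m _ => by rw [K.vel_symm]; ring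
  simp only [e', MetricAlgebra.covTwo, e, K.Γ_symm j i, K.Γ_symm k i, K.Γ_symm k j]
  linear_combination (K.D i (K.vel j k) + K.D j (K.vel i k) - K.D k (K.vel i j))
    * two_mul_half (A := A)

/-- The components `R̃_{i0k}^l` of the space-time curvature. -/
def mixedCurv (i k l : ι) : A :=
  K.D i (K.velUp k l) - K.Dt (K.Γ i k l)
    + ∑ m, K.velUp k m * K.Γ i m l - ∑ m, K.Γ i k m * K.velUp m l

/-- The component is ∇_i v_k^l - ∂_t Γ_{ik}^l, and ∇_i v_k^l cancels one of the three terms of ∂_t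
Γ. -/
theorem mixedCurv_eq_sum (i k l : ι) : K.mixedCurv i k l
    = ∑ m, K.gi l m * (K.covTwo K.vel m i k - K.covTwo K.vel k i m) := by
  have h := K.covMixed_raise K.vel i k l
  simp only [← velUp_eq] at h
  have h' : K.mixedCurv i k l = K.covMixed (fun j l => K.velUp j l) i k l - K.Dt (K.Γ i k l) := by
    simp only [mixedCurv, MetricAlgebra.covMixed, mul_comm (K.velUp k _)]
    ring
  rw [h', h, Dt_Γ]
  simp only [mul_add, mul_sub, sum_add_distrib, sum_sub_distrib]
  ring

theorem covTwo_vel (i j k : ι) :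
    K.covTwo K.vel i j k = -K.covTwo K.ric i j k + K.covTwo (K.hess K.f) i j k := by
  simp only [MetricAlgebra.covTwo, vel, map_add, map_neg, mul_add, mul_neg, sum_add_distrib, sum_neg_distrib]
  ring

theorem mixedCurv_eq (i k l : ι) : K.mixedCurv i k l
    = -∑ m, K.gi l m * K.covTwo K.ric m i k + K.covMixed K.ricUp k i l
      + ∑ p, K.riem i p k l * K.grad K.f p := by
  have h : K.covMixed K.ricUp k i l = ∑ m, K.gi l m * K.covTwo K.ric k i m :=
    K.covMixed_raise K.ric k i l
  rw [h, ← K.sum_gi_covTwo_hess_sub, mixedCurv_eq_sum]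
  simp only [covTwo_vel, mul_add, mul_sub, mul_neg, sum_add_distrib, sum_sub_distrib,
    sum_neg_distrib]
  ring

/-- The Ricci part of v gives the two derivatives of Ric; the Hessian part is the commutator of
covariant derivatives on ∇f. -/
theorem spaceCurv_eq (i j l : ι) :
    K.D i (K.velUp j l) - K.D j (K.velUp i l)
      + ∑ m, K.velUp j m * K.Γ i m l - ∑ m, K.velUp i m * K.Γ j m l
    = -K.covMixed K.ricUp i j l + K.covMixed K.ricUp j i l
      + ∑ p, K.riem i j p l * K.grad K.f p := by
  rw [← K.ricci_identity_vec]
  simp only [velUp, MetricAlgebra.covMixed, map_add, map_neg, add_mul, neg_mul, sum_add_distrib, sum_neg_distrib,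
    MetricAlgebra.hessUp, mul_comm (K.ricUp _ _), K.Γ_symm j i]
  ring

theorem covMixedTwo_add (K : MetricAlgebra ι A) (B C : ι → ι → ι → A) (h i j l : ι) :
    K.covMixedTwo (fun i j l => B i j l + C i j l) h i j l
      = K.covMixedTwo B h i j l + K.covMixedTwo C h i j l := by
  simp only [MetricAlgebra.covMixedTwo, map_add, mul_add, sum_add_distrib]
  ring

theorem covMixedTwo_neg (K : MetricAlgebra ι A) (B : ι → ι → ι → A) (h i j l : ι) :
    K.covMixedTwo (fun i j l => -B i j l) h i j l = -K.covMixedTwo B h i j l := by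
  simp only [MetricAlgebra.covMixedTwo, map_neg, mul_neg, sum_neg_distrib]
  ring

theorem covForm_add (K : MetricAlgebra ι A) (α β : ι → A) (i j : ι) :
    K.covForm (fun j => α j + β j) i j = K.covForm α i j + K.covForm β i j := by
  simp only [MetricAlgebra.covForm, map_add, mul_add, sum_add_distrib]
  ring

theorem covForm_half_mul (K : MetricAlgebra ι A) (α : ι → A) (i j : ι) :
    K.covForm (fun j => half A * α j) i j = half A * K.covForm α i j := by
  simp only [MetricAlgebra.covForm, derivation_half_mul, mul_left_comm _ (half A), ← mul_sum]
  ring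

/-- The evolution of the curvature tensor. -/
theorem Dt_riem (i j k l : ι) : K.Dt (K.riem i j k l)
    = ∑ m, K.velUp k m * K.riem i j m l - ∑ m, K.riem i j k m * K.velUp m l
      - K.covMixedTwo K.mixedCurv i j k l + K.covMixedTwo K.mixedCurv j i k l := by
  -- Time is the first of the three directions, with v as connection matrix. The curvature in the
  -- (i, t) plane is then `mixedCurv`, and the identity can be solved for ∂_t Riem.
  have e := congrFun (congrFun (gauge_bianchi (K.Dt_comm i) (K.Dt_comm j) (K.D_comm i j)
    (Matrix.of K.velUp) (K.Γm i) (K.Γm j)) k) l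
  have h₁ (i k l : ι) : gaugeCurv (K.D i) K.Dt (K.Γm i) (Matrix.of K.velUp) k l
      = K.mixedCurv i k l := by
    simp [gaugeCurv, Γm, mixedCurv, Matrix.mul_apply]
  have h₂ (i k l : ι) : gaugeCurv K.Dt (K.D i) (Matrix.of K.velUp) (K.Γm i) k l
      = -K.mixedCurv i k l := by
    rw [← h₁]
    simp only [gaugeCurv, Matrix.add_apply, Matrix.sub_apply]
    ring
  simp only [Matrix.add_apply, Matrix.sub_apply, Matrix.mul_apply, Matrix.map_apply,
    gaugeCurv_Γm, Matrix.zero_apply, h₁, h₂, Matrix.of_apply] at e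
  simp only [Γm, Matrix.of_apply, map_neg, mul_neg, neg_mul,
    sum_neg_distrib, mul_comm (K.mixedCurv _ _ _)] at e
  simp only [MetricAlgebra.covMixedTwo, K.Γ_symm j i]
  linear_combination e

/-- The Laplacian of the Ricci tensor. -/
def lapRic (j k : ι) : A :=
  ∑ p, ∑ m, K.gi p m * K.covThree (K.covTwo K.ric) p m j k

/-- The divergence of Ric contributes -½∇R, the trace of ∇_k Ric contributes ∇R, and the curvature
term contracts to Ric. -/
theorem sum_mixedCurv (k : ι) : ∑ p, K.mixedCurv p k p
    = half A * K.D k K.scal + ∑ q, K.ric q k * K.grad K.f q := by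
  have h₁ : ∑ p, ∑ m, K.gi p m * K.covTwo K.ric m p k = half A * K.D k K.scal := by
    rw [← K.sum_covMixed_ricUp, sum_comm]
    refine sum_congr rfl fun m _ => ?_
    refine Eq.trans ?_ (K.covMixed_raise K.ric m k m).symm
    exact sum_congr rfl fun p _ => by rw [K.gi_symm, K.covTwo_symm _ K.ric_symm]
  have h₂ : ∑ p, K.covMixed K.ricUp k p p = K.D k K.scal := K.sum_covMixed K.ricUp k
  have h₃ : ∑ p, ∑ q, K.riem p q k p * K.grad K.f q = ∑ q, K.ric q k * K.grad K.f q := by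
    rw [sum_comm]
    simp only [MetricAlgebra.ric, sum_mul]
  simp only [mixedCurv_eq, sum_add_distrib, sum_neg_distrib, h₁, h₂, h₃]
  linear_combination (-K.D k K.scal) * two_mul_half (A := A)

/-- The divergence in the upper index, for each of the three terms of `mixedCurv_eq`. The first
gives the Laplacian of Ric. In the second, ∇_p∇_k R_j^p is commuted to ∇_k∇_p R_j^p, half the
Hessian of R, at the cost of curvature terms. The third uses the product rule and the contracted
Bianchi identity. -/
theorem sum_covMixedTwo_mixedCurv (j k : ι) : ∑ p, K.covMixedTwo K.mixedCurv p j k p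
    = -K.lapRic j k + (half A * K.hess K.scal k j + ∑ m, K.ric k m * K.ricUp j m
        - ∑ p, ∑ m, K.riem p k j m * K.ricUp m p)
      + (∑ q, (K.covTwo K.ric j q k - K.covTwo K.ric q j k) * K.grad K.f q
        + ∑ p, ∑ q, K.riem j q k p * K.hessUp K.f p q) := by
  have h₀ : K.mixedCurv = fun i k l => -(∑ m, K.gi l m * K.covTwo K.ric m i k)
      + K.covMixed K.ricUp k i l + ∑ p, K.riem i p k l * K.grad K.f p := by
    ext; rw [mixedCurv_eq]
  have h₁ (p : ι) : K.covMixedTwo (fun i k l => ∑ m, K.gi l m * K.covTwo K.ric m i k) p j k p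
      = ∑ m, K.gi p m * K.covThree (K.covTwo K.ric) p m j k := by
    rw [K.covMixedTwo_raise (fun i k m => K.covTwo K.ric m i k)]
    refine sum_congr rfl fun m _ => ?_
    simp only [MetricAlgebra.covThree]
    ring
  have h₂ (p : ι) : K.covMixedTwo (fun i k l => K.covMixed K.ricUp k i l) p j k p
      = K.covMixedTwo (K.covMixed K.ricUp) k p j p
        + ∑ m, K.riem p k m p * K.ricUp j m - ∑ m, K.riem p k j m * K.ricUp m p := by
    rw [add_sub_assoc, ← K.ricci_identity_mixed]
    simp only [MetricAlgebra.covMixedTwo]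
    ring
  have h₂' : ∑ p, K.covMixedTwo (K.covMixed K.ricUp) k p j p = half A * K.hess K.scal k j := by
    rw [K.sum_covMixedTwo]
    simp only [K.sum_covMixed_ricUp, covForm_half_mul]
    rfl
  have h₂'' : ∑ p, ∑ m, K.riem p k m p * K.ricUp j m = ∑ m, K.ric k m * K.ricUp j m := by
    rw [sum_comm]
    simp only [MetricAlgebra.ric, sum_mul]
  have h₃ : ∑ p, ∑ q, K.covMixedThree K.riem p j q k p * K.grad K.f q
      = ∑ q, (K.covTwo K.ric j q k - K.covTwo K.ric q j k) * K.grad K.f q := by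
    rw [sum_comm]
    simp only [← K.sum_covMixedThree_riem, sum_mul]
  rw [h₀]
  simp only [covMixedTwo_add, covMixedTwo_neg, h₁, h₂, K.covMixedTwo_contract_vec,
    sum_add_distrib, sum_sub_distrib, sum_neg_distrib, h₂', h₂'', h₃]
  rfl

/-- Pair symmetry exchanges j and k together with the two summation indices, and Ric is symmetric in
the latter. -/
theorem sum_riem_mul_ricUp_symm (j k : ι) : ∑ p, ∑ m, K.riem p j k m * K.ricUp m p
    = ∑ p, ∑ m, K.riem p k j m * K.ricUp m p := by
  have h (j k : ι) : ∑ p, ∑ m, K.riem p j k m * K.ricUp m p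
      = ∑ m, ∑ t, (∑ p, K.gi t p * K.riem p j k m) * K.ric m t := by
    rw [sum_comm]
    refine sum_congr rfl fun m _ => ?_
    simp only [MetricAlgebra.ricUp]
    rw [sum_mul_sum_transpose]
    exact sum_congr rfl fun t _ => by simp only [K.gi_symm t]
  rw [h j k, h k j, sum_comm]
  simp only [K.sum_gi_riem k j, ← sum_neg_distrib, ← mul_neg, ← K.riem_antisymm]
  exact sum_congr rfl fun t _ => sum_congr rfl fun m _ => by rw [K.ric_symm]

/-- The evolution of the Ricci tensor. -/
theorem Dt_ric (j k : ι) : K.Dt (K.ric j k)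
    = K.lapRic j k + ∑ q, K.covTwo K.ric q j k * K.grad K.f q
      - ∑ m, K.ricUp k m * K.ric j m + ∑ m, K.hessUp K.f k m * K.ric j m
      + 2 * ∑ p, ∑ m, K.riem p j k m * K.ricUp m p
      - ∑ m, K.ric k m * K.ricUp j m + ∑ m, K.ric k m * K.hessUp K.f j m := by
  have h₁ : ∑ p, ∑ m, K.velUp k m * K.riem p j m p
      = -∑ m, K.ricUp k m * K.ric j m + ∑ m, K.hessUp K.f k m * K.ric j m := by
    rw [sum_comm, ← sum_neg_distrib, ← sum_add_distrib]
    refine sum_congr rfl fun m _ => ?_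
    rw [← mul_sum, velUp, MetricAlgebra.ric]
    ring
  have h₂ : ∑ p, ∑ m, K.riem p j k m * K.velUp m p
      = -∑ p, ∑ m, K.riem p j k m * K.ricUp m p
        - ∑ p, ∑ q, K.riem j q k p * K.hessUp K.f p q := by
    rw [sum_comm (f := fun p q => K.riem j q k p * K.hessUp K.f p q)]
    simp only [velUp, mul_add, mul_neg, sum_add_distrib, sum_neg_distrib, K.riem_antisymm j,
      neg_mul, sub_neg_eq_add]
  have h₃ : ∑ p, K.covMixedTwo K.mixedCurv j p k p = half A * K.hess K.scal j k
      + (∑ q, K.covTwo K.ric j q k * K.grad K.f q + ∑ q, K.ric k q * K.hessUp K.f j q) := by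
    rw [K.sum_covMixedTwo]
    simp only [sum_mixedCurv, covForm_add, covForm_half_mul, K.covForm_contract_vec,
      K.ric_symm k]
    rfl
  have h₀ : K.Dt (K.ric j k) = ∑ p, K.Dt (K.riem p j k p) := map_sum ..
  -- The two halves of the Hessian of R cancel, as do the products of Riem with Hess f and the terms
  -- ∇_j R_{qk} ∇^q f; the two products of Riem with Ric coincide, whence the factor 2.
  simp only [h₀, Dt_riem, sum_add_distrib, sum_sub_distrib, h₁, h₂, h₃, sum_covMixedTwo_mixedCurv,
    sub_mul, ← K.sum_riem_mul_ricUp_symm j k, K.hess_symm K.scal k]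
  ring

theorem sum_Dt_gi (y : ι → ι → A) (i l : ι) : ∑ m, K.Dt (K.gi l m) * y i m
    = -2 * ∑ t, (∑ s, K.gi t s * y i s) * K.velUp t l := by
  simp only [velUp_eq, ← K.sum_gi_sum_mul K.vel y K.vel_symm, Dt_gi, neg_mul, mul_assoc,
    sum_neg_distrib, ← mul_sum, sum_sum_mul (K.gi l)]

/-- The Laplacian of a tensor `B_i^l`. -/
def lapMixed (B : ι → ι → A) (i l : ι) : A :=
  ∑ a, ∑ b, K.gi a b * K.covMixedTwo (K.covMixed B) a b i l

theorem lapMixed_ricUp (i l : ι) : K.lapMixed K.ricUp i l = ∑ m, K.gi l m * K.lapRic i m := by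
  have h₁ : K.covMixed K.ricUp = fun b i l => ∑ m, K.gi l m * K.covTwo K.ric b i m := by
    ext b i l
    exact K.covMixed_raise K.ric b i l
  have h₂ (a b : ι) : K.covMixedTwo (K.covMixed K.ricUp) a b i l
      = ∑ m, K.gi l m * K.covThree (K.covTwo K.ric) a b i m := by
    rw [h₁, K.covMixedTwo_raise]
  have h₃ (a : ι) (c : ι → ι → A) : ∑ b, K.gi a b * ∑ m, K.gi l m * c b m
      = ∑ m, K.gi l m * ∑ b, K.gi a b * c b m := sum_mul_sum_comm ..
  simp only [lapMixed, h₂, h₃, lapRic]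
  rw [sum_comm]
  simp only [mul_sum]

/-- The evolution of the Ricci tensor with an index raised. -/
theorem Dt_ricUp (i l : ι) : K.Dt (K.ricUp i l)
    = K.lapMixed K.ricUp i l + ∑ q, K.grad K.f q * K.covMixed K.ricUp q i l
      + 2 * ∑ m, ∑ p, ∑ r, K.gi l m * K.riem p i m r * K.ricUp r p
      - ∑ p, K.ricUp i p * K.hessUp K.f p l + ∑ p, K.ricUp p l * K.hessUp K.f i p := by
  have h₁ : ∑ m, K.gi l m * ∑ s, K.ricUp m s * K.ric i s = ∑ t, K.ricUp i t * K.ricUp t l :=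
    K.sum_gi_sum_mul K.ric K.ric K.ric_symm i l
  have h₂ : ∑ m, K.gi l m * ∑ s, K.hessUp K.f m s * K.ric i s
      = ∑ t, K.ricUp i t * K.hessUp K.f t l := by
    simp only [K.hessUp_eq]
    exact K.sum_gi_sum_mul (K.hess K.f) K.ric (K.hess_symm _) i l
  have h₃ (v : ι → A) : ∑ m, K.gi l m * ∑ s, K.ric m s * v s = ∑ s, K.ricUp s l * v s := by
    simp only [mul_comm (K.ric _ _)]
    rw [sum_mul_sum_comm]
    exact sum_congr rfl fun s _ => by
      rw [mul_comm]; simp only [MetricAlgebra.ricUp, K.ric_symm s]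
  have h₄ : ∑ m, K.gi l m * ∑ q, K.covTwo K.ric q i m * K.grad K.f q
      = ∑ q, K.grad K.f q * K.covMixed K.ricUp q i l := by
    simp only [mul_comm _ (K.grad _ _)]
    rw [sum_mul_sum_comm]
    exact sum_congr rfl fun q _ => congrArg _ (K.covMixed_raise K.ric q i l).symm
  have h₅ : ∑ t, K.ricUp i t * K.velUp t l
      = -∑ t, K.ricUp i t * K.ricUp t l + ∑ t, K.ricUp i t * K.hessUp K.f t l := by
    simp only [velUp, mul_add, mul_neg, sum_add_distrib, sum_neg_distrib]
  have h₆ : K.Dt (K.ricUp i l) = ∑ m, K.gi l m * K.Dt (K.ric i m)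
      + ∑ m, K.Dt (K.gi l m) * K.ric i m := derivation_sum_mul ..
  have h₇ : ∑ t, K.ricUp t l * K.ricUp i t = ∑ t, K.ricUp i t * K.ricUp t l := by
    simp only [mul_comm]
  have h₈ : ∑ m, K.gi l m * (2 * ∑ p, ∑ r, K.riem p i m r * K.ricUp r p)
      = 2 * ∑ m, ∑ p, ∑ r, K.gi l m * K.riem p i m r * K.ricUp r p := by
    simp only [mul_left_comm _ (2 : A), ← mul_sum, mul_assoc]
  have h₉ : ∑ t, (∑ s, K.gi t s * K.ric i s) * K.velUp t l = ∑ t, K.ricUp i t * K.velUp t l := rfl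
  rw [h₆, sum_Dt_gi, h₉, h₅, lapMixed_ricUp]
  -- The two copies of -R_i^t R_t^l coming from ∂_t R_{im} cancel against twice that product coming
  -- from ∂_t g⁻¹.
  simp only [Dt_ric, mul_add, mul_sub, sum_add_distrib, sum_sub_distrib, h₁, h₂, h₃, h₄, h₇, h₈]
  ring

theorem Dt_hess (h : A) (i m : ι) : K.Dt (K.hess h i m)
    = K.hess (K.Dt h) i m - ∑ p, K.Dt (K.Γ i m p) * K.D p h := by
  simp only [MetricAlgebra.hess, MetricAlgebra.covForm, map_sub, derivation_sum_mul, K.Dt_comm]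
  ring

/-- The first term comes from ∂_t g⁻¹, the last from ∂_t Γ. Contracted with ∇f, the latter is a
derivative of v plus `mixedCurv`, whose formula is already known. -/
theorem Dt_hessUp (i l : ι) : K.Dt (K.hessUp K.f i l)
    = -2 * ∑ t, K.hessUp K.f i t * K.velUp t l + K.hessUp (K.Dt K.f) i l
      - ∑ q, (K.covMixed K.velUp i q l + K.mixedCurv i q l) * K.grad K.f q := by
  have h₁ (m : ι) : ∑ p, K.Dt (K.Γ i m p) * K.D p K.f
      = ∑ q, K.grad K.f q * (K.covTwo K.vel i m q + K.covTwo K.vel m i q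
        - K.covTwo K.vel q i m) := by
    simp only [Dt_Γ]
    rw [sum_sum_mul_mul K.gi]
    simp only [MetricAlgebra.grad, K.gi_symm]
  have h₂ (q : ι) : K.covMixed K.velUp i q l = ∑ m, K.gi l m * K.covTwo K.vel i m q := by
    have : K.velUp = fun i l => ∑ m, K.gi l m * K.vel i m := by ext; rw [velUp_eq]
    rw [this, K.covMixed_raise]
    exact sum_congr rfl fun m _ => by rw [K.covTwo_symm _ K.vel_symm]
  have h₃ : ∑ m, K.gi l m * ∑ p, K.Dt (K.Γ i m p) * K.D p K.f
      = ∑ q, (K.covMixed K.velUp i q l + K.mixedCurv i q l) * K.grad K.f q := by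
    simp only [h₁]
    rw [sum_mul_sum_comm]
    refine sum_congr rfl fun q _ => ?_
    rw [mul_comm, h₂, mixedCurv_eq_sum, ← sum_add_distrib]
    exact congrArg (· * _) (sum_congr rfl fun m _ => by ring)
  rw [K.hessUp_eq, derivation_sum_mul, sum_Dt_gi]
  simp only [Dt_hess, mul_sub, sum_sub_distrib, h₃, ← K.hessUp_eq]
  ring

/-- The components `Γ̃_{00}^k` of the space-time connection. -/
def accel (k : ι) : A :=
  K.grad (-(half A * K.scal) + K.Dt K.f - half A * K.gradSq K.f) k

/-- The components `R̃_{i00}^l` of the space-time curvature. -/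
def timeCurv (i l : ι) : A :=
  K.D i (K.accel l) - K.Dt (K.velUp i l)
    + ∑ m, K.accel m * K.Γ i m l - ∑ m, K.velUp i m * K.velUp m l

/-- The potential of Γ̃_{00} is what makes the bad terms vanish. Its part ∂_t f cancels Hess(∂_t f)
in ∂_t(Hess f). Its part -½|∇f|² cancels ∇(Hess f)·∇f and one square of Hess f; the quadratic term
v·v removes the other. -/
theorem timeCurv_eq (i l : ι) : K.timeCurv i l
    = K.Dt (K.ricUp i l) - ∑ p, K.grad K.f p * K.covMixed K.ricUp p i l
      - half A * K.hessUp K.scal i l - ∑ p, K.ricUp i p * K.ricUp p l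
      - ∑ p, (K.covMixed K.ricUp i p l - K.covMixed K.ricUp p i l) * K.grad K.f p
      - ∑ p, (∑ m, K.gi l m * K.covTwo K.ric m i p - K.covMixed K.ricUp p i l) * K.grad K.f p
      + ∑ p, K.ricUp i p * K.hessUp K.f p l - ∑ p, K.ricUp p l * K.hessUp K.f i p
      + ∑ p, ∑ r, K.riem i p r l * K.grad K.f p * K.grad K.f r := by
  have h₁ : K.D i (K.accel l) + ∑ m, K.accel m * K.Γ i m l = -(half A * K.hessUp K.scal i l)
      + K.hessUp (K.Dt K.f) i l - half A * K.hessUp (K.gradSq K.f) i l := by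
    have h (a b c : A) : K.hessUp (-(half A * a) + b - half A * c) i l
        = -(half A * K.hessUp a i l) + K.hessUp b i l - half A * K.hessUp c i l := by
      have e : -(half A * a) + b - half A * c = half A * -a + b + half A * -c := by ring
      have n (x : A) : K.hessUp (-x) i l = -K.hessUp x i l := by
        have := K.hessUp_add x (-x) i l
        have z : K.hessUp 0 i l = 0 := by
          simp [MetricAlgebra.hessUp, MetricAlgebra.covVec, MetricAlgebra.grad]
        rw [add_neg_cancel, z] at this
        linear_combination -this
      rw [e, K.hessUp_add, K.hessUp_add, K.hessUp_half_mul, K.hessUp_half_mul, n, n]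
      ring
    rw [← h]
    simp only [mul_comm (K.accel _)]
    rfl
  have h₂ : ∑ m, K.gi l m * ∑ q, K.covTwo (K.hess K.f) i q m * K.grad K.f q
      = ∑ q, K.covMixed (K.hessUp K.f) i q l * K.grad K.f q := by
    have : K.hessUp K.f = fun i l => ∑ m, K.gi l m * K.hess K.f i m := by
      ext; rw [K.hessUp_eq]
    simp only [this, K.covMixed_raise, mul_comm _ (K.grad _ _)]
    rw [sum_mul_sum_comm]
  have h₃ (q : ι) : K.covMixed K.velUp i q l
      = -K.covMixed K.ricUp i q l + K.covMixed (K.hessUp K.f) i q l := by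
    simp only [MetricAlgebra.covMixed, velUp, map_add, map_neg, mul_add, mul_neg, sum_add_distrib,
      sum_neg_distrib]
    ring
  have h₄ : ∑ q, (∑ p, K.riem i p q l * K.grad K.f p) * K.grad K.f q
      = ∑ p, ∑ r, K.riem i p r l * K.grad K.f p * K.grad K.f r := by
    simp only [sum_mul]
    rw [sum_comm]
  have h₅ : K.Dt (K.velUp i l) = -K.Dt (K.ricUp i l) + K.Dt (K.hessUp K.f i l) := by
    simp only [velUp, map_add, map_neg]
  have h₆ : K.timeCurv i l = (K.D i (K.accel l) + ∑ m, K.accel m * K.Γ i m l)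
      - K.Dt (K.velUp i l) - ∑ m, K.velUp i m * K.velUp m l := by
    rw [timeCurv]; ring
  rw [h₆, h₁, h₅, Dt_hessUp, K.hessUp_gradSq, h₂, ← h₄]
  simp only [h₃, mixedCurv_eq, velUp, add_mul, sub_mul, neg_mul, mul_add, mul_neg,
    sum_add_distrib, sum_sub_distrib, sum_neg_distrib, mul_comm (K.grad _ _),
    mul_comm (K.ricUp _ l) (K.hessUp _ _ _)]
  linear_combination (-∑ q, K.covMixed (K.hessUp K.f) i q l * K.grad K.f q
    - ∑ q, K.hessUp K.f i q * K.hessUp K.f q l) * two_mul_half (A := A)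

/-- Inserting the evolution of R_i^l cancels the transport term ∇^p f ∇_p R_i^l and the products of
Ric with Hess f. The remaining first derivatives of Ric are regrouped into P. -/
theorem timeCurv_eq_lap (i l : ι) : K.timeCurv i l
    = K.lapMixed K.ricUp i l - half A * K.hessUp K.scal i l
      + 2 * ∑ m, ∑ p, ∑ r, K.gi l m * K.riem p i m r * K.ricUp r p
      - ∑ m, K.ricUp m l * K.ricUp i m
      - ∑ p, ∑ r, K.gi r l * (K.covTwo K.ric i p r - K.covTwo K.ric p i r) * K.grad K.f p
      - ∑ p, ∑ r, K.gi r l * (K.covTwo K.ric r p i - K.covTwo K.ric p r i) * K.grad K.f p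
      + ∑ p, ∑ r, K.riem i p r l * K.grad K.f p * K.grad K.f r := by
  have h (a b : ι) : ∑ r, K.gi r l * K.covTwo K.ric a b r = K.covMixed K.ricUp a b l := by
    refine Eq.trans ?_ (K.covMixed_raise K.ric a b l).symm
    exact sum_congr rfl fun r _ => by rw [K.gi_symm]
  have h' (a b : ι) : ∑ r, K.gi r l * K.covTwo K.ric a r b = K.covMixed K.ricUp a b l := by
    rw [← h]
    exact sum_congr rfl fun r _ => by rw [K.covTwo_symm _ K.ric_symm]
  have h'' (p : ι) : ∑ r, K.gi r l * K.covTwo K.ric r p i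
      = ∑ m, K.gi l m * K.covTwo K.ric m i p :=
    sum_congr rfl fun r _ => by rw [K.covTwo_symm _ K.ric_symm, K.gi_symm]
  rw [timeCurv_eq, Dt_ricUp]
  simp only [← sum_mul, mul_sub, sum_sub_distrib, h, h', h'', mul_comm (K.ricUp _ l) (K.ricUp _ _)]
  ring

end FlowAlgebra

/-! ### The algebra of smooth functions on a set, with its derivations -/

section SmoothFunctions

variable {E : Type*} [NormedAddCommGroup E] [NormedSpace ℝ E]

/-- The algebra of smooth functions on a subset `S` of a normed space. -/
def SmoothFun (S : Set E) : Subalgebra ℝ (S → ℝ) where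
  carrier := {h | ∃ F : E → ℝ, ContDiffOn ℝ ∞ F S ∧ ∀ p : S, h p = F p}
  mul_mem' := by
    rintro a b ⟨F, hF, ha⟩ ⟨H, hH, hb⟩
    exact ⟨fun p => F p * H p, hF.mul hH, fun p => by simp [ha, hb]⟩
  add_mem' := by
    rintro a b ⟨F, hF, ha⟩ ⟨H, hH, hb⟩
    exact ⟨fun p => F p + H p, hF.add hH, fun p => by simp [ha, hb]⟩
  algebraMap_mem' r := ⟨fun _ => r, contDiffOn_const, fun _ => rfl⟩

namespace SmoothFun

variable {S : Set E}

/-- The restriction to `S` of a function that is smooth on `S`. -/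
def of (F : E → ℝ) (hF : ContDiffOn ℝ ∞ F S) : SmoothFun S := ⟨S.domRestrict F, F, hF, fun _ => rfl⟩

/-- Evaluation at a point. -/
def ev (p : S) : SmoothFun S →ₐ[ℝ] ℝ := (Pi.evalAlgHom ℝ (fun _ : S => ℝ) p).comp (SmoothFun S).val

theorem ext_ev {a b : SmoothFun S} (h : ∀ p, ev p a = ev p b) : a = b :=
  Subtype.ext (funext h)

/-- The function `F` agrees with `a` on `S`. -/
def Rep (F : E → ℝ) (a : SmoothFun S) : Prop := ∀ p : S, F p = ev p a

theorem rep_of {F : E → ℝ} (hF : ContDiffOn ℝ ∞ F S) : Rep F (of F hF) := fun _ => rfl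

theorem Rep.contDiffOn {F : E → ℝ} {a : SmoothFun S} (h : Rep F a) : ContDiffOn ℝ ∞ F S := by
  obtain ⟨H, hH, ha⟩ := a.2
  exact hH.congr fun p hp => (h ⟨p, hp⟩).trans (ha ⟨p, hp⟩)

theorem exists_rep (a : SmoothFun S) : ∃ F, Rep F a := by
  obtain ⟨H, hH, ha⟩ := a.2
  exact ⟨H, fun p => (ha p).symm⟩

theorem contDiffOn_fderivWithin_apply (hS : UniqueDiffOn ℝ S) {F : E → ℝ}
    (hF : ContDiffOn ℝ ∞ F S) (v : E) : ContDiffOn ℝ ∞ (fun p => fderivWithin ℝ F S p v) S :=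
  (hF.fderivWithin hS (by simp)).clm_apply contDiffOn_const

/-- The derivative within S sees only values on S, so derivations of the algebra do not depend on
the chosen extension. -/
theorem Rep.fderivWithin_eq {F H : E → ℝ} {a : SmoothFun S} (h : Rep F a) (h' : Rep H a) (p : S) :
    fderivWithin ℝ F S p = fderivWithin ℝ H S p :=
  fderivWithin_congr (fun x hx => (h ⟨x, hx⟩).trans (h' ⟨x, hx⟩).symm) ((h p).trans (h' p).symm)

/-- The derivative in the direction of a constant vector. -/
def derivFun (hS : UniqueDiffOn ℝ S) (v : E) (a : SmoothFun S) : SmoothFun S :=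
  of (fun p => fderivWithin ℝ (exists_rep a).choose S p v)
    (contDiffOn_fderivWithin_apply hS (exists_rep a).choose_spec.contDiffOn v)

theorem ev_derivFun (hS : UniqueDiffOn ℝ S) (v : E) {F : E → ℝ} {a : SmoothFun S} (h : Rep F a)
    (p : S) : ev p (derivFun hS v a) = fderivWithin ℝ F S p v := by
  rw [h.fderivWithin_eq (exists_rep a).choose_spec]
  rfl

theorem Rep.differentiableWithinAt {F : E → ℝ} {a : SmoothFun S} (h : Rep F a) (p : S) :
    DifferentiableWithinAt ℝ F S p :=
  h.contDiffOn.differentiableOn (by simp) p p.2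

theorem Rep.add {F H : E → ℝ} {a b : SmoothFun S} (h : Rep F a) (h' : Rep H b) :
    Rep (fun p => F p + H p) (a + b) := fun p => by
  rw [map_add, ← h, ← h']

theorem Rep.mul {F H : E → ℝ} {a b : SmoothFun S} (h : Rep F a) (h' : Rep H b) :
    Rep (fun p => F p * H p) (a * b) := fun p => by
  rw [map_mul, ← h, ← h']

theorem rep_algebraMap (r : ℝ) : Rep (fun _ => r) (algebraMap ℝ (SmoothFun S) r) := fun p => by
  rw [AlgHom.commutes]; rfl

/-- The derivation in the direction of a constant vector. -/
def D (hS : UniqueDiffOn ℝ S) (v : E) : Derivation ℝ (SmoothFun S) (SmoothFun S) := by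
  have hadd (a b : SmoothFun S) : derivFun hS v (a + b) = derivFun hS v a + derivFun hS v b := by
    obtain ⟨F, hF⟩ := exists_rep a
    obtain ⟨H, hH⟩ := exists_rep b
    refine ext_ev fun p => ?_
    rw [map_add, ev_derivFun hS v (hF.add hH), ev_derivFun hS v hF, ev_derivFun hS v hH,
      fderivWithin_fun_add (hS p p.2) (hF.differentiableWithinAt p) (hH.differentiableWithinAt p)]
    rfl
  have hmul (a b : SmoothFun S) :
      derivFun hS v (a * b) = a * derivFun hS v b + b * derivFun hS v a := by
    obtain ⟨F, hF⟩ := exists_rep a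
    obtain ⟨H, hH⟩ := exists_rep b
    refine ext_ev fun p => ?_
    rw [map_add, map_mul, map_mul, ev_derivFun hS v (hF.mul hH), ev_derivFun hS v hF,
      ev_derivFun hS v hH,
      fderivWithin_fun_mul (hS p p.2) (hF.differentiableWithinAt p) (hH.differentiableWithinAt p),
      ← hF p, ← hH p]
    rfl
  have hconst (r : ℝ) : derivFun hS v (algebraMap ℝ (SmoothFun S) r) = 0 := by
    refine ext_ev fun p => ?_
    rw [ev_derivFun hS v (rep_algebraMap r)]
    simp
  exact Derivation.mk'
    { toFun := derivFun hS v
      map_add' := hadd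
      map_smul' := fun r a => by
        rw [Algebra.smul_def, hmul, hconst, mul_zero, add_zero, RingHom.id_apply,
          Algebra.smul_def] }
    fun a b => hmul a b

theorem ev_D (hS : UniqueDiffOn ℝ S) (v : E) {F : E → ℝ} {a : SmoothFun S} (h : Rep F a)
    (p : S) : ev p (D hS v a) = fderivWithin ℝ F S p v :=
  ev_derivFun hS v h p

/-- Symmetry of second derivatives within S also holds at boundary points that are limits of
interior points; this covers t = 0. -/
theorem D_comm (hS : UniqueDiffOn ℝ S) (hS' : S ⊆ closure (interior S)) (v w : E)
    (a : SmoothFun S) : D hS v (D hS w a) = D hS w (D hS v a) := by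
  obtain ⟨F, hF⟩ := exists_rep a
  have hrep (v : E) : Rep (fun p => fderivWithin ℝ F S p v) (D hS v a) := fun p =>
    (ev_D hS v hF p).symm
  refine ext_ev fun p => ?_
  have hd : DifferentiableWithinAt ℝ (fderivWithin ℝ F S) S p :=
    (hF.contDiffOn.fderivWithin hS (m := ∞) (by simp)).differentiableOn (by simp) p p.2
  have hsymm : IsSymmSndFDerivWithinAt ℝ F S p :=
    (hF.contDiffOn p p.2).isSymmSndFDerivWithinAt
      (by rw [minSmoothness_of_isRCLikeNormedField]; exact WithTop.coe_le_coe.2 le_top) hS (hS' p.2) p.2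
  rw [ev_D hS v (hrep w), ev_D hS w (hrep v),
    fderivWithin_clm_apply (hS p p.2) hd (differentiableWithinAt_const _),
    fderivWithin_clm_apply (hS p p.2) hd (differentiableWithinAt_const _)]
  simpa using hsymm v w

/-- A smooth function without zeros is a unit. -/
theorem isUnit_of_ev_ne_zero {a : SmoothFun S} (h : ∀ p, ev p a ≠ 0) : IsUnit a := by
  obtain ⟨F, hF⟩ := exists_rep a
  have h0 : ∀ p ∈ S, F p ≠ 0 := fun p hp => by rw [hF ⟨p, hp⟩]; exact h _
  refine IsUnit.of_mul_eq_one (of (fun p => (F p)⁻¹) (hF.contDiffOn.inv h0)) (ext_ev fun p => ?_)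
  rw [map_mul, map_one, ← hF p]
  exact mul_inv_cancel₀ (h0 p p.2)

end SmoothFun

end SmoothFunctions

open SmoothFun

/-! ### The time interval -/

theorem convex_timeInterval (T : EReal) : Convex ℝ (timeInterval T) := by
  refine Set.OrdConnected.convex ⟨fun a ha b hb c hc => ⟨ha.1.trans hc.1, ?_⟩⟩
  exact lt_of_le_of_lt (EReal.coe_le_coe_iff.2 hc.2) hb.2

theorem interior_timeInterval_nonempty {T : EReal} {t : ℝ} (ht : t ∈ timeInterval T) :
    (interior (timeInterval T)).Nonempty := by
  obtain ⟨s, hts, hsT⟩ := EReal.lt_iff_exists_real_btwn.1 ht.2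
  have hts : t < s := EReal.coe_lt_coe_iff.1 hts
  refine ⟨(t + s) / 2, interior_mono (s := Set.Ioo t s) (fun r hr => ?_) ?_⟩
  · exact ⟨ht.1.trans hr.1.le, lt_trans (EReal.coe_lt_coe_iff.2 hr.2) hsT⟩
  · rw [interior_Ioo]
    constructor <;> linarith

theorem uniqueDiffOn_timeInterval (T : EReal) : UniqueDiffOn ℝ (timeInterval T) := fun t ht =>
  uniqueDiffOn_convex (convex_timeInterval T) (interior_timeInterval_nonempty ht) t ht

theorem timeInterval_subset_closure_interior (T : EReal) :
    timeInterval T ⊆ closure (interior (timeInterval T)) := fun t ht => by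
  rw [(convex_timeInterval T).closure_interior_eq_closure_of_nonempty_interior
    (interior_timeInterval_nonempty ht)]
  exact subset_closure ht

theorem add_mem_timeInterval {T : EReal} {τ t : ℝ} (hτ : τ ∈ timeInterval T)
    (ht : t ∈ timeInterval (T - (τ : EReal))) : t + τ ∈ timeInterval T := by
  refine ⟨add_nonneg ht.1 hτ.1, ?_⟩
  rw [EReal.coe_add]
  exact EReal.add_lt_of_lt_sub ht.2

/-! ### Representation of local functions -/

section Local

variable {n : ℕ} {T : EReal} {U : Set (EuclideanSpace ℝ (Fin n))}

theorem uniqueDiffOn_prod (hU : IsOpen U) : UniqueDiffOn ℝ (U ×ˢ timeInterval T) :=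
  hU.uniqueDiffOn.prod (uniqueDiffOn_timeInterval T)

theorem prod_subset_closure_interior (hU : IsOpen U) :
    U ×ˢ timeInterval T ⊆ closure (interior (U ×ˢ timeInterval T)) := by
  rw [interior_prod_eq, closure_prod_eq, hU.interior_eq]
  exact Set.prod_mono subset_closure (timeInterval_subset_closure_interior T)

theorem dx_eq (hU : IsOpen U) {F : LocalFun n} {p : EuclideanSpace ℝ (Fin n) × ℝ}
    (hp : p ∈ U ×ˢ timeInterval T) (hF : DifferentiableWithinAt ℝ F (U ×ˢ timeInterval T) p)
    (i : Fin n) :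
    dx i F p = fderivWithin ℝ F (U ×ˢ timeInterval T) p (EuclideanSpace.single i 1, 0) := by
  have h : HasFDerivWithinAt (fun v => F (v, p.2))
      ((fderivWithin ℝ F (U ×ˢ timeInterval T) p).comp (ContinuousLinearMap.inl ℝ _ ℝ)) U p.1 :=
    HasFDerivWithinAt.comp (g := F) (t := U ×ˢ timeInterval T) p.1 hF.hasFDerivWithinAt
      (hasFDerivAt_prodMk_left p.1 p.2).hasFDerivWithinAt (fun v hv => ⟨hv, hp.2⟩)
  rw [dx, (h.hasFDerivAt (hU.mem_nhds hp.1)).fderiv]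
  rfl

theorem hasDerivWithinAt_time {F : LocalFun n} {p : EuclideanSpace ℝ (Fin n) × ℝ}
    (hp : p ∈ U ×ˢ timeInterval T) (hF : DifferentiableWithinAt ℝ F (U ×ˢ timeInterval T) p) :
    HasDerivWithinAt (fun s => F (p.1, s))
      (fderivWithin ℝ F (U ×ˢ timeInterval T) p (0, 1)) (timeInterval T) p.2 := by
  have h : HasFDerivWithinAt (fun s => F (p.1, s))
      ((fderivWithin ℝ F (U ×ˢ timeInterval T) p).comp (ContinuousLinearMap.inr ℝ _ ℝ))
      (timeInterval T) p.2 :=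
    HasFDerivWithinAt.comp (g := F) (t := U ×ˢ timeInterval T) p.2 hF.hasFDerivWithinAt
      (hasFDerivAt_prodMk_right p.1 p.2).hasFDerivWithinAt (fun s hs => ⟨hp.1, hs⟩)
  simpa using h.hasDerivWithinAt

theorem dt_eq {F : LocalFun n} {p : EuclideanSpace ℝ (Fin n) × ℝ}
    (hp : p ∈ U ×ˢ timeInterval T) (hF : DifferentiableWithinAt ℝ F (U ×ˢ timeInterval T) p) :
    dt (timeInterval T) F p = fderivWithin ℝ F (U ×ˢ timeInterval T) p (0, 1) :=
  (hasDerivWithinAt_time hp hF).derivWithin (uniqueDiffOn_timeInterval T p.2 hp.2)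

/-- Chain rule for s ↦ s + τ, which maps [0, T - τ) into [0, T). At t = 0 the left side is one-sided
even if τ > 0 is interior to [0, T); unique differentiability makes the two derivatives agree. -/
theorem dt_shift_eq {F : LocalFun n} {u : EuclideanSpace ℝ (Fin n)} (hu : u ∈ U) {τ t : ℝ}
    (hτ : τ ∈ timeInterval T) (ht : t ∈ timeInterval (T - (τ : EReal)))
    (hF : DifferentiableWithinAt ℝ F (U ×ˢ timeInterval T) (u, t + τ)) :
    dt (timeInterval (T - (τ : EReal))) (fun p => F (p.1, p.2 + τ)) (u, t)
      = fderivWithin ℝ F (U ×ˢ timeInterval T) (u, t + τ) (0, 1) := by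
  have h := hasDerivWithinAt_time (p := (u, t + τ)) ⟨hu, add_mem_timeInterval hτ ht⟩ hF
  have h' : HasDerivWithinAt (fun s => F (u, s + τ))
      (fderivWithin ℝ F (U ×ˢ timeInterval T) (u, t + τ) (0, 1))
      (timeInterval (T - (τ : EReal))) t := by
    have := HasDerivWithinAt.scomp (h := fun s => s + τ) t h
      (((hasDerivAt_id t).add_const τ).hasDerivWithinAt)
      (fun s hs => add_mem_timeInterval hτ hs)
    rw [one_smul] at this
    exact this
  exact h'.derivWithin (uniqueDiffOn_timeInterval _ t ht)

/-- Smooth functions on `U × [0, T)`. -/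
abbrev SpaceTimeFun (U : Set (EuclideanSpace ℝ (Fin n))) (T : EReal) :
    Subalgebra ℝ (U ×ˢ timeInterval T → ℝ) := SmoothFun (U ×ˢ timeInterval T)

/-- The metric algebra of smooth functions given by a time-dependent metric. -/
def metricAlgebra (hU : IsOpen U) (G : Fin n → Fin n → LocalFun n)
    (hG : ∀ i j, ContDiffOn ℝ ∞ (G i j) (U ×ˢ timeInterval T))
    (hsymm : ∀ i j, ∀ p ∈ U ×ˢ timeInterval T, G i j p = G j i p)
    (hdet : ∀ p ∈ U ×ˢ timeInterval T, (Matrix.of fun a b => G a b p).det ≠ 0) :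
    MetricAlgebra (Fin n) (SpaceTimeFun U T) where
  D i := SmoothFun.D (uniqueDiffOn_prod hU) (EuclideanSpace.single i 1, 0)
  g i j := SmoothFun.of (G i j) (hG i j)
  gi i j := ((Matrix.of fun a b => SmoothFun.of (G a b) (hG a b))⁻¹ :
    Matrix (Fin n) (Fin n) (SpaceTimeFun U T)) i j
  D_comm i j a := SmoothFun.D_comm _ (prod_subset_closure_interior hU) _ _ a
  g_symm i j := ext_ev fun p => hsymm i j p p.2
  gi_symm i j := by
    have hM : (Matrix.of fun a b => SmoothFun.of (G a b) (hG a b)).transpose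
        = Matrix.of fun a b => SmoothFun.of (G a b) (hG a b) :=
      Matrix.ext fun a b => ext_ev fun p => hsymm b a p p.2
    have := congrFun (congrFun (Matrix.transpose_nonsing_inv
      (Matrix.of fun a b => SmoothFun.of (G a b) (hG a b))) j) i
    rw [hM] at this
    exact this
  gi_mul_g i j := by
    have hu : IsUnit (Matrix.of fun a b => SmoothFun.of (G a b) (hG a b)).det := by
      refine isUnit_of_ev_ne_zero fun p => ?_
      rw [AlgHom.map_det]
      exact hdet p p.2
    have := congrFun (congrFun (Matrix.nonsing_inv_mul _ hu) i) j
    rw [Matrix.mul_apply, Matrix.one_apply] at this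
    exact this

end Local

/-- The metric algebra `K` of smooth functions on `U × [0, T)` describes the metric `G`. -/
structure Represents {n : ℕ} {T : EReal} {U : Set (EuclideanSpace ℝ (Fin n))}
    (G : Fin n → Fin n → LocalFun n) (K : MetricAlgebra (Fin n) (SpaceTimeFun U T)) : Prop where
  rep_g : ∀ i j, Rep (G i j) (K.g i j)
  rep_ginv : ∀ i j, Rep (ginv G i j) (K.gi i j)
  rep_dx : ∀ i {F : LocalFun n} {a : SpaceTimeFun U T}, Rep F a → Rep (dx i F) (K.D i a)

section Local

variable {n : ℕ} {T : EReal} {U : Set (EuclideanSpace ℝ (Fin n))}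

theorem represents_metricAlgebra (hU : IsOpen U) (G : Fin n → Fin n → LocalFun n)
    (hG : ∀ i j, ContDiffOn ℝ ∞ (G i j) (U ×ˢ timeInterval T))
    (hsymm : ∀ i j, ∀ p ∈ U ×ˢ timeInterval T, G i j p = G j i p)
    (hdet : ∀ p ∈ U ×ˢ timeInterval T, (Matrix.of fun a b => G a b p).det ≠ 0) :
    Represents G (metricAlgebra hU G hG hsymm hdet) where
  rep_g i j := rep_of (hG i j)
  rep_ginv i j p := by
    -- `ginv` inverts a real matrix at each point, `gi` a matrix over the algebra; evaluation at p
    -- sends the latter to a left inverse, which is unique.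
    have h : (Matrix.of fun a b => G a b p)⁻¹
        = Matrix.of fun a b => ev p ((metricAlgebra hU G hG hsymm hdet).gi a b) := by
      refine Matrix.inv_eq_left_inv (Matrix.ext fun a b => ?_)
      have := congrArg (ev p) ((metricAlgebra hU G hG hsymm hdet).gi_mul_g a b)
      simp only [map_sum, map_mul, apply_ite (ev p), map_one, map_zero] at this
      rw [Matrix.mul_apply, Matrix.one_apply, ← this]
      rfl
    rw [ginv, h]
    rfl
  rep_dx i F a h p := by
    rw [dx_eq hU p.2 (h.differentiableWithinAt p)]
    exact (ev_D _ _ h p).symm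

theorem ev_half {S : Set (EuclideanSpace ℝ (Fin n) × ℝ)} (p : S) :
    ev p (MetricAlgebra.half (SmoothFun S)) = 1 / 2 := (ev p).commutes (1 / 2)

/-! ### Dictionary between coordinate expressions and the algebra -/

namespace Represents

variable {G : Fin n → Fin n → LocalFun n} {K : MetricAlgebra (Fin n) (SpaceTimeFun U T)}
  (hK : Represents G K)

include hK

theorem christoffel (i j k : Fin n) : Rep (christoffel G i j k) (K.Γ i j k) := fun p => by
  simp only [SpacetimeRicci.christoffel, MetricAlgebra.Γ, map_mul, map_sum, map_add, map_sub,
    ev_half, hK.rep_ginv _ _ p, hK.rep_dx _ (hK.rep_g _ _) p]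

theorem riem (i j k l : Fin n) : Rep (riem G i j k l) (K.riem i j k l) := fun p => by
  simp only [SpacetimeRicci.riem, curvature, MetricAlgebra.riem, map_mul, map_sum, map_add,
    map_sub, hK.christoffel _ _ _ p, hK.rep_dx _ (hK.christoffel _ _ _) p]

theorem ric (j k : Fin n) : Rep (ric G j k) (K.ric j k) := fun p => by
  simp only [SpacetimeRicci.ric, MetricAlgebra.ric, map_sum, hK.riem _ _ _ _ p]

theorem ricUp (i l : Fin n) : Rep (ricUp G i l) (K.ricUp i l) := fun p => by
  simp only [SpacetimeRicci.ricUp, MetricAlgebra.ricUp, map_sum, map_mul, hK.ric _ _ p,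
    hK.rep_ginv _ _ p]

theorem scal : Rep (scal G) K.scal := fun p => by
  simp only [SpacetimeRicci.scal, MetricAlgebra.scal, map_sum, map_mul, hK.ric _ _ p,
    hK.rep_ginv _ _ p]

theorem covVec {V : Fin n → LocalFun n} {v : Fin n → SpaceTimeFun U T}
    (h : ∀ k, Rep (V k) (v k)) (i k : Fin n) : Rep (covVec G V i k) (K.covVec v i k) := fun p => by
  simp only [SpacetimeRicci.covVec, MetricAlgebra.covVec, map_sum, map_mul, map_add, h _ p,
    hK.christoffel _ _ _ p, hK.rep_dx _ (h _) p]

theorem covForm {α : Fin n → LocalFun n} {a : Fin n → SpaceTimeFun U T}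
    (h : ∀ k, Rep (α k) (a k)) (i j : Fin n) :
    Rep (covForm G α i j) (K.covForm a i j) := fun p => by
  simp only [SpacetimeRicci.covForm, MetricAlgebra.covForm, map_sum, map_mul, map_sub, h _ p,
    hK.christoffel _ _ _ p, hK.rep_dx _ (h _) p]

theorem covTwo {B : Fin n → Fin n → LocalFun n} {b : Fin n → Fin n → SpaceTimeFun U T}
    (h : ∀ j k, Rep (B j k) (b j k)) (i j k : Fin n) :
    Rep (covTwo G B i j k) (K.covTwo b i j k) := fun p => by
  simp only [SpacetimeRicci.covTwo, MetricAlgebra.covTwo, map_sum, map_mul, map_sub, h _ _ p,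
    hK.christoffel _ _ _ p, hK.rep_dx _ (h _ _) p]

theorem covMixed {B : Fin n → Fin n → LocalFun n} {b : Fin n → Fin n → SpaceTimeFun U T}
    (h : ∀ j k, Rep (B j k) (b j k)) (i j l : Fin n) :
    Rep (covMixed G B i j l) (K.covMixed b i j l) := fun p => by
  simp only [SpacetimeRicci.covMixed, MetricAlgebra.covMixed, map_sum, map_mul, map_sub, map_add,
    h _ _ p, hK.christoffel _ _ _ p, hK.rep_dx _ (h _ _) p]

theorem covMixedTwo {B : Fin n → Fin n → Fin n → LocalFun n}
    {b : Fin n → Fin n → Fin n → SpaceTimeFun U T}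
    (h : ∀ i j k, Rep (B i j k) (b i j k)) (i j k l : Fin n) :
    Rep (covMixedTwo G B i j k l) (K.covMixedTwo b i j k l) := fun p => by
  simp only [SpacetimeRicci.covMixedTwo, MetricAlgebra.covMixedTwo, map_sum, map_mul, map_sub,
    map_add, h _ _ _ p, hK.christoffel _ _ _ p, hK.rep_dx _ (h _ _ _) p]

theorem grad {F : LocalFun n} {f : SpaceTimeFun U T} (h : Rep F f) (k : Fin n) :
    Rep (grad G F k) (K.grad f k) := fun p => by
  simp only [SpacetimeRicci.grad, MetricAlgebra.grad, map_sum, map_mul, hK.rep_ginv _ _ p,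
    hK.rep_dx _ h p]

theorem hess {F : LocalFun n} {f : SpaceTimeFun U T} (h : Rep F f) (i j : Fin n) :
    Rep (hess G F i j) (K.hess f i j) :=
  hK.covForm (fun k => hK.rep_dx k h) i j

theorem hessUp {F : LocalFun n} {f : SpaceTimeFun U T} (h : Rep F f) (i k : Fin n) :
    Rep (hessUp G F i k) (K.hessUp f i k) :=
  hK.covVec (hK.grad h) i k

theorem gradSq {F : LocalFun n} {f : SpaceTimeFun U T} (h : Rep F f) :
    Rep (gradSq G F) (K.gradSq f) := fun p => by
  simp only [SpacetimeRicci.gradSq, MetricAlgebra.gradSq, map_sum, map_mul, hK.grad h _ p,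
    hK.rep_dx _ h p]

theorem dRic (i j k : Fin n) : Rep (dRic G i j k) (K.covTwo K.ric i j k) := hK.covTwo hK.ric i j k

theorem dRicUp (i j l : Fin n) : Rep (dRicUp G i j l) (K.covMixed K.ricUp i j l) :=
  hK.covMixed hK.ricUp i j l

theorem dUpRic (l i k : Fin n) :
    Rep (dUpRic G l i k) (∑ m, K.gi l m * K.covTwo K.ric m i k) := fun p => by
  simp only [SpacetimeRicci.dUpRic, map_sum, map_mul, hK.rep_ginv _ _ p, hK.dRic _ _ _ p]

theorem tensorP (i j k : Fin n) :
    Rep (tensorP G i j k) (K.covTwo K.ric i j k - K.covTwo K.ric j i k) := fun p => by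
  simp only [SpacetimeRicci.tensorP, map_sub, hK.dRic _ _ _ p]

end Represents

theorem rep_dt (hU : IsOpen U) {F : LocalFun n} {a : SpaceTimeFun U T} (h : Rep F a) :
    Rep (dt (timeInterval T) F) (SmoothFun.D (uniqueDiffOn_prod hU) (0, 1) a) := fun p => by
  rw [dt_eq p.2 (h.differentiableWithinAt p)]
  exact (ev_D _ _ h p).symm

/-- The flow algebra of a solution of the modified Ricci flow in local coordinates. -/
def flowAlgebra (hU : IsOpen U) {G : Fin n → Fin n → LocalFun n}
    (hG : ∀ i j, ContDiffOn ℝ ∞ (G i j) (U ×ˢ timeInterval T))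
    (hsymm : ∀ i j, ∀ p ∈ U ×ˢ timeInterval T, G i j p = G j i p)
    (hdet : ∀ p ∈ U ×ˢ timeInterval T, (Matrix.of fun a b => G a b p).det ≠ 0)
    {F : LocalFun n} (hF : ContDiffOn ℝ ∞ F (U ×ˢ timeInterval T))
    (hflow : ∀ i j, ∀ p ∈ U ×ˢ timeInterval T,
      dt (timeInterval T) (G i j) p = -2 * ric G i j p + 2 * hess G F i j p) :
    FlowAlgebra (Fin n) (SpaceTimeFun U T) where
  toMetricAlgebra := metricAlgebra hU G hG hsymm hdet
  Dt := SmoothFun.D (uniqueDiffOn_prod hU) (0, 1)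
  f := SmoothFun.of F hF
  Dt_comm i a := SmoothFun.D_comm _ (prod_subset_closure_interior hU) _ _ a
  flow i j := ext_ev fun p => by
    have hK := represents_metricAlgebra hU G hG hsymm hdet
    rw [← rep_dt hU (hK.rep_g i j) p, hflow i j p p.2, hK.ric i j p, hK.hess (rep_of hF) i j p]
    simp only [map_add, map_mul, map_neg, map_ofNat]

end Local

/-- The Gram matrix of a positive definite form in the image of the standard basis is
nondegenerate. -/
theorem det_gram_ne_zero {n : ℕ} {V : Type*} [AddCommGroup V] [Module ℝ V] [TopologicalSpace V]
    [IsTopologicalAddGroup V] [ContinuousSMul ℝ V] (L : EuclideanSpace ℝ (Fin n) →L[ℝ] V)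
    (hL : Function.Injective L) (B : V →L[ℝ] V →L[ℝ] ℝ) (hB : ∀ v, v ≠ 0 → 0 < B v v) :
    (Matrix.of fun i j => B (L (EuclideanSpace.single i 1)) (L (EuclideanSpace.single j 1))).det
      ≠ 0 := by
  intro hdet
  -- A kernel vector v of the Gram matrix gives the nonzero vector x = ∑ v_i e_i with B(Lx, Lx) =
  -- vᵀMv = 0, against positivity.
  obtain ⟨v, hv, hMv⟩ := Matrix.exists_mulVec_eq_zero_iff.2 hdet
  set x : EuclideanSpace ℝ (Fin n) := ∑ i, v i • EuclideanSpace.single i (1 : ℝ) with hx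
  have hx0 : x ≠ 0 := by
    contrapose! hv
    ext i
    have := congrArg (fun y : EuclideanSpace ℝ (Fin n) => y i) hv
    simpa [hx, Pi.single_apply] using this
  have hLx : L x ≠ 0 := fun h => hx0 (hL (h.trans (map_zero L).symm))
  refine (hB _ hLx).ne' ?_
  have hrow (i : Fin n) : ∑ j, B (L (EuclideanSpace.single i 1)) (L (EuclideanSpace.single j 1))
      * v j = 0 := congrFun hMv i
  have h : B (L x) (L x) = ∑ i, v i * ∑ j, B (L (EuclideanSpace.single i 1))
      (L (EuclideanSpace.single j 1)) * v j := by
    rw [hx]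
    simp only [map_sum, map_smul, _root_.sum_apply, smul_apply, smul_eq_mul, mul_sum]
    rw [sum_comm]
    exact sum_congr rfl fun _ _ => sum_congr rfl fun _ _ => by ring
  rw [h]
  simp only [hrow, mul_zero, sum_const_zero]

/-! ### The metric and the potential in a chart -/

section Chart

variable {n : ℕ} {M : Type*} [TopologicalSpace M] [ChartedSpace (EuclideanSpace ℝ (Fin n)) M]
  {φ : OpenPartialHomeomorph M (EuclideanSpace ℝ (Fin n))}

theorem injective_mfderiv_symm [IsManifold (𝓡 n) ∞ M]
    (hφ : φ ∈ IsManifold.maximalAtlas (𝓡 n) ∞ M) {u : EuclideanSpace ℝ (Fin n)}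
    (hu : u ∈ φ.target) : Function.Injective (mfderiv (𝓡 n) (𝓡 n) φ.symm u) := by
  have h₁ : MDifferentiableAt (𝓡 n) (𝓡 n) φ.symm u :=
    (contMDiffAt_symm_of_mem_maximalAtlas hφ hu).mdifferentiableAt (by simp)
  have h₂ : MDifferentiableAt (𝓡 n) (𝓡 n) φ (φ.symm u) :=
    (contMDiffAt_of_mem_maximalAtlas hφ (φ.map_target hu)).mdifferentiableAt (by simp)
  have h₃ : (φ ∘ φ.symm) =ᶠ[nhds u] id := by
    filter_upwards [φ.open_target.mem_nhds hu] with v hv using φ.right_inv hv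
  have h₄ := mfderiv_comp u h₂ h₁
  rw [h₃.mfderiv_eq, mfderiv_id] at h₄
  intro x y hxy
  have hx := congrArg (fun L => L x) h₄
  have hy := congrArg (fun L => L y) h₄
  have : mfderiv (𝓡 n) (𝓡 n) φ (φ.symm u) (mfderiv (𝓡 n) (𝓡 n) φ.symm u x)
      = mfderiv (𝓡 n) (𝓡 n) φ (φ.symm u) (mfderiv (𝓡 n) (𝓡 n) φ.symm u y) := by rw [hxy]
  exact hx.trans (this.trans hy.symm)

theorem metricComp_symm (g : ℝ → Bundle.RiemannianMetric (fun x : M => TangentSpace (𝓡 n) x))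
    (i j : Fin n) (p : EuclideanSpace ℝ (Fin n) × ℝ) :
    metricComp g φ i j p = metricComp g φ j i p :=
  (g p.2).symm _ _ _

theorem det_metricComp_ne_zero [IsManifold (𝓡 n) ∞ M]
    (g : ℝ → Bundle.RiemannianMetric (fun x : M => TangentSpace (𝓡 n) x))
    (hφ : φ ∈ IsManifold.maximalAtlas (𝓡 n) ∞ M) {p : EuclideanSpace ℝ (Fin n) × ℝ}
    (hp : p.1 ∈ φ.target) : (Matrix.of fun a b => metricComp g φ a b p).det ≠ 0 := by
  exact det_gram_ne_zero (mfderiv (𝓡 n) (𝓡 n) φ.symm p.1) (injective_mfderiv_symm hφ hp)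
    ((g p.2).inner (φ.symm p.1)) ((g p.2).pos (φ.symm p.1))

theorem contDiffOn_funComp [IsManifold (𝓡 n) ∞ M] {f : M × ℝ → ℝ} {I : Set ℝ}
    (hf : ContMDiffOn ((𝓡 n).prod 𝓘(ℝ, ℝ)) 𝓘(ℝ, ℝ) ∞ f (Set.univ ×ˢ I))
    (hφ : φ ∈ IsManifold.maximalAtlas (𝓡 n) ∞ M) :
    ContDiffOn ℝ ∞ (funComp f φ) (φ.target ×ˢ I) := by
  have h : ContMDiffOn ((𝓡 n).prod 𝓘(ℝ, ℝ)) 𝓘(ℝ, ℝ) ∞ (funComp f φ) (φ.target ×ˢ I) := by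
    refine hf.comp (f := fun p : EuclideanSpace ℝ (Fin n) × ℝ => (φ.symm p.1, p.2)) ?_
      fun p hp => ⟨trivial, hp.2⟩
    refine ContMDiffOn.prodMk ?_ contMDiffOn_snd
    exact (contMDiffOn_symm_of_mem_maximalAtlas hφ).comp contMDiffOn_fst fun p hp => hp.1
  -- The product manifold structure on the coordinate space times ℝ is identified with its structure
  -- as a normed space.
  rw [← contMDiffOn_iff_contDiffOn, modelWithCornersSelf_prod, ← chartedSpaceSelf_prod]
  exact h

end Chart

/-! ### The space-time curvature in local coordinates -/

section SpaceTime

variable {n : ℕ} {T : EReal} {U : Set (EuclideanSpace ℝ (Fin n))} {τ t : ℝ}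
  {u : EuclideanSpace ℝ (Fin n)}

theorem dt_shift (hU : IsOpen U) {F : LocalFun n} {a : SpaceTimeFun U T} (h : Rep F a)
    (hu : u ∈ U) (hτ : τ ∈ timeInterval T) (ht : t ∈ timeInterval (T - (τ : EReal))) :
    dt (timeInterval (T - (τ : EReal))) (fun p => F (p.1, p.2 + τ)) (u, t)
      = ev (S := U ×ˢ timeInterval T) ⟨(u, t + τ), hu, add_mem_timeInterval hτ ht⟩
        (SmoothFun.D (uniqueDiffOn_prod hU) (0, 1) a) := by
  rw [ev_D _ _ h]
  exact dt_shift_eq hu hτ ht (h.differentiableWithinAt ⟨(u, t + τ), hu, add_mem_timeInterval hτ ht⟩)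

variable {G : Fin n → Fin n → LocalFun n} {F : LocalFun n}
  {K : FlowAlgebra (Fin n) (SpaceTimeFun U T)}

theorem rep_velUp (hK : Represents G K.toMetricAlgebra) (hF : Rep F K.f) (a c : Fin n) :
    Rep (fun q => -ricUp G a c q + hessUp G F a c q) (K.velUp a c) := fun p => by
  simp only [FlowAlgebra.velUp, map_add, map_neg, hK.ricUp _ _ p, hK.hessUp hF _ _ p]

theorem rep_accel (hK : Represents G K.toMetricAlgebra) (hF : Rep F K.f)
    (hdt : Rep (dt (timeInterval T) F) (K.Dt K.f)) (c : Fin n) :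
    Rep (grad G (fun r => -(1 / 2 : ℝ) * scal G r + dt (timeInterval T) F r
            - (1 / 2 : ℝ) * gradSq G F r) c) (K.accel c) := by
  refine hK.grad (fun p => ?_) c
  simp only [map_add, map_sub, map_neg, map_mul, ev_half, hK.scal p, hdt p, hK.gradSq hF p]
  ring

theorem rep_lapMixed (hK : Represents G K.toMetricAlgebra) (i l : Fin n) :
    Rep (laplacianMixed G (ricUp G) i l) (K.lapMixed K.ricUp i l) := fun p => by
  simp only [laplacianMixed, FlowAlgebra.lapMixed, map_sum, map_mul, hK.rep_ginv _ _ p,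
    hK.covMixedTwo (fun i j k => hK.covMixed hK.ricUp i j k) _ _ _ _ p]

/-- The space-time curvature of a solution of the modified Ricci flow in local coordinates. -/
theorem stRiem_eq (hU : IsOpen U)
    (hG : ∀ i j, ContDiffOn ℝ ∞ (G i j) (U ×ˢ timeInterval T))
    (hsymm : ∀ i j, ∀ p ∈ U ×ˢ timeInterval T, G i j p = G j i p)
    (hdet : ∀ p ∈ U ×ˢ timeInterval T, (Matrix.of fun a b => G a b p).det ≠ 0)
    (hF : ContDiffOn ℝ ∞ F (U ×ˢ timeInterval T))
    (hflow : ∀ i j, ∀ p ∈ U ×ˢ timeInterval T,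
      dt (timeInterval T) (G i j) p = -2 * ric G i j p + 2 * hess G F i j p)
    (hτ : τ ∈ timeInterval T) (hu : u ∈ U) (ht : t ∈ timeInterval (T - (τ : EReal))) :
    let q : EuclideanSpace ℝ (Fin n) × ℝ := (u, t + τ)
    (∀ i j k l : Fin n,
      stRiem T τ G F i.succ j.succ k.succ l.succ (u, t) = riem G i j k l q) ∧
    (∀ i j k : Fin n, stRiem T τ G F i.succ j.succ k.succ 0 (u, t) = 0) ∧
    (∀ i j l : Fin n, stRiem T τ G F i.succ j.succ 0 l.succ (u, t)
      = -dRicUp G i j l q + dRicUp G j i l q + ∑ p, riem G i j p l q * grad G F p q) ∧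
    (∀ i k l : Fin n, stRiem T τ G F i.succ 0 k.succ l.succ (u, t)
      = -dUpRic G l i k q + dRicUp G k i l q + ∑ p, riem G i p k l q * grad G F p q) ∧
    (∀ i l : Fin n, stRiem T τ G F i.succ 0 0 l.succ (u, t)
      = dt (timeInterval T) (ricUp G i l) q
        - ∑ p, grad G F p q * dRicUp G p i l q
        - (1 / 2 : ℝ) * hessUp G (scal G) i l q
        - ∑ p, ricUp G i p q * ricUp G p l q
        - ∑ p, (dRicUp G i p l q - dRicUp G p i l q) * grad G F p q
        - ∑ p, (dUpRic G l i p q - dRicUp G p i l q) * grad G F p q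
        + ∑ p, ricUp G i p q * hessUp G F p l q
        - ∑ p, ricUp G p l q * hessUp G F i p q
        + ∑ p, ∑ r, riem G i p r l q * grad G F p q * grad G F r q) ∧
    (∀ i l : Fin n, stRiem T τ G F i.succ 0 0 l.succ (u, t)
      = laplacianMixed G (ricUp G) i l q
        - (1 / 2 : ℝ) * hessUp G (scal G) i l q
        + 2 * ∑ m, ∑ p, ∑ r, ginv G l m q * riem G p i m r q * ricUp G r p q
        - ∑ m, ricUp G m l q * ricUp G i m q
        - ∑ p, ∑ r, ginv G r l q * tensorP G i p r q * grad G F p q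
        - ∑ p, ∑ r, ginv G r l q * tensorP G r p i q * grad G F p q
        + ∑ p, ∑ r, riem G i p r l q * grad G F p q * grad G F r q) := by
  intro q
  set K := flowAlgebra hU hG hsymm hdet hF hflow
  have hK : Represents G K.toMetricAlgebra := represents_metricAlgebra hU G hG hsymm hdet
  have hf : Rep F K.f := rep_of hF
  have hdt {H : LocalFun n} {a : SpaceTimeFun U T} (h : Rep H a) :
      Rep (dt (timeInterval T) H) (K.Dt a) := rep_dt hU h
  set q' : (U ×ˢ timeInterval T : Set _) := ⟨q, hu, add_mem_timeInterval hτ ht⟩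
  have hqq {H : LocalFun n} {a : SpaceTimeFun U T} (h : Rep H a) : H q = ev q' a := h q'
  have hdx {H : LocalFun n} {a : SpaceTimeFun U T} (i : Fin n) (h : Rep H a) :
      dx i (fun p => H (p.1, p.2 + τ)) (u, t) = ev q' (K.D i a) := hK.rep_dx i h q'
  have hdts {H : LocalFun n} {a : SpaceTimeFun U T} (h : Rep H a) :
      dt (timeInterval (T - (τ : EReal))) (fun p => H (p.1, p.2 + τ)) (u, t) = ev q' (K.Dt a) :=
    dt_shift hU h hu hτ ht
  have hvel := rep_velUp hK hf
  have hacc := rep_accel hK hf (hdt hf)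
  have hΓ (a b c : Fin n) : stGamma G T τ F a.succ b.succ c.succ
      = fun p => christoffel G a b c (p.1, p.2 + τ) := rfl
  have hΓ₀ (i j : Fin (n + 1)) : stGamma G T τ F i j 0 = fun _ => 0 := rfl
  have hΓ₁ (b c : Fin n) : stGamma G T τ F 0 b.succ c.succ
      = fun p => -ricUp G b c (p.1, p.2 + τ) + hessUp G F b c (p.1, p.2 + τ) := rfl
  have hΓ₂ (a c : Fin n) : stGamma G T τ F a.succ 0 c.succ
      = fun p => -ricUp G a c (p.1, p.2 + τ) + hessUp G F a c (p.1, p.2 + τ) := rfl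
  have hΓ₃ (c : Fin n) : stGamma G T τ F 0 0 c.succ
      = fun p => grad G (fun r => -(1 / 2 : ℝ) * scal G r + dt (timeInterval T) F r
            - (1 / 2 : ℝ) * gradSq G F r) c (p.1, p.2 + τ) := rfl
  have hD (S : Set ℝ) (a : Fin n) (H : LocalFun n) : stD S a.succ H = dx a H := rfl
  have hD₀ (S : Set ℝ) (H : LocalFun n) : stD S 0 H = dt S H := rfl
  have eΓ (a b c : Fin n) : christoffel G a b c (u, t + τ) = ev q' (K.Γ a b c) :=
    hK.christoffel a b c q'
  have evel (a c : Fin n) : -ricUp G a c (u, t + τ) + hessUp G F a c (u, t + τ)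
      = ev q' (K.velUp a c) := hvel a c q'
  have eacc (c : Fin n) : grad G (fun r => -(1 / 2 : ℝ) * scal G r + dt (timeInterval T) F r
      - (1 / 2 : ℝ) * gradSq G F r) c (u, t + τ) = ev q' (K.accel c) := hacc c q'
  -- The summand m = 0 of each quadratic term contains a factor Γ̃_{jk}^0 = 0, so only spatial
  -- summation indices remain.
  have htime (i l : Fin n) : stRiem T τ G F i.succ 0 0 l.succ (u, t) = ev q' (K.timeCurv i l) := by
    simp only [stRiem, curvature, Fin.sum_univ_succ, hΓ, hΓ₀, hΓ₁, hΓ₂, hΓ₃, hD, hD₀,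
      hdx i (hacc l), hdts (hvel i l), FlowAlgebra.timeCurv, map_add, map_sub, map_mul, map_sum,
      zero_mul, zero_add, eΓ, evel, eacc]
  refine ⟨fun i j k l => ?_, fun i j k => ?_, fun i j l => ?_, fun i k l => ?_, fun i l => ?_,
    fun i l => ?_⟩
  · simp only [stRiem, curvature, Fin.sum_univ_succ, hΓ, hΓ₀, hD, zero_mul, zero_add]
    rfl
  · simp only [stRiem, curvature, hΓ₀, hD]
    simp [dx]
  · have := congrArg (ev q') (K.spaceCurv_eq i j l)
    simp only [map_add, map_sub, map_neg, map_mul, map_sum, ← hqq (hK.dRicUp _ _ _),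
      ← hqq (hK.riem _ _ _ _), ← hqq (hK.grad hf _)] at this
    rw [← this]
    simp only [stRiem, curvature, Fin.sum_univ_succ, hΓ, hΓ₀, hΓ₂, hD, hdx _ (hvel _ _),
      zero_mul, zero_add, eΓ, evel]
  · have := K.mixedCurv_eq i k l
    rw [FlowAlgebra.mixedCurv] at this
    replace this := congrArg (ev q') this
    -- Evaluation is pushed only through the sum containing ∇f: the sum g^{lm} ∇_m R_{ik} must stay
    -- whole to be recognised as `dUpRic`.
    simp only [map_add, map_sub, map_neg, map_mul, map_sum (ev q') (fun p => _ * K.grad K.f p),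
      ← hqq (hK.dUpRic _ _ _), ← hqq (hK.dRicUp _ _ _), ← hqq (hK.riem _ _ _ _),
      ← hqq (hK.grad hf _)] at this
    rw [← this]
    simp only [stRiem, curvature, Fin.sum_univ_succ, hΓ, hΓ₀, hΓ₁, hΓ₂, hD, hD₀,
      hdx _ (hvel _ _), hdts (hK.christoffel _ _ _), zero_mul, zero_add, eΓ, evel,
      map_sum, map_mul]
  · rw [htime, FlowAlgebra.timeCurv_eq]
    simp only [map_add, map_sub, map_mul, map_sum, ev_half, hqq (hdt (hK.ricUp i l)),
      hqq (hK.grad hf _), hqq (hK.dRicUp _ _ _), hqq (hK.hessUp hK.scal _ _),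
      hqq (hK.ricUp _ _), hqq (hK.dUpRic _ _ _), hqq (hK.hessUp hf _ _), hqq (hK.riem _ _ _ _)]
  · rw [htime, FlowAlgebra.timeCurv_eq_lap]
    simp only [map_add, map_sub, map_mul, map_sum, map_ofNat, ev_half, hqq (rep_lapMixed hK _ _),
      hqq (hK.rep_ginv _ _), hqq (hK.tensorP _ _ _),
      hqq (hK.grad hf _), hqq (hK.hessUp hK.scal _ _),
      hqq (hK.ricUp _ _), hqq (hK.riem _ _ _ _)]

end SpaceTime

end SpacetimeRicci

end

open SpacetimeRicci in
theorem theorem3p1 {n : ℕ} {M : Type*} [TopologicalSpace M]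
    [ChartedSpace (EuclideanSpace ℝ (Fin n)) M] [IsManifold (𝓡 n) ∞ M]
    (T : EReal) (g : ℝ → Bundle.RiemannianMetric (fun x : M => TangentSpace (𝓡 n) x))
    (f : M × ℝ → ℝ) (hflow : IsModifiedRicciFlow T g f)
    (τ : ℝ) (hτ : τ ∈ timeInterval T)
    (φ : OpenPartialHomeomorph M (EuclideanSpace ℝ (Fin n)))
    (hφ : φ ∈ IsManifold.maximalAtlas (𝓡 n) ∞ M)
    (u : EuclideanSpace ℝ (Fin n)) (hu : u ∈ φ.target)
    (t : ℝ) (ht : t ∈ timeInterval (T - (τ : EReal))) :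
    let G := metricComp g φ
    let F := funComp f φ
    let q : EuclideanSpace ℝ (Fin n) × ℝ := (u, t + τ)
    (∀ i j k l : Fin n,
      stRiem T τ G F i.succ j.succ k.succ l.succ (u, t) = riem G i j k l q) ∧
    (∀ i j k : Fin n, stRiem T τ G F i.succ j.succ k.succ 0 (u, t) = 0) ∧
    (∀ i j l : Fin n, stRiem T τ G F i.succ j.succ 0 l.succ (u, t)
      = -dRicUp G i j l q + dRicUp G j i l q + ∑ p, riem G i j p l q * grad G F p q) ∧
    (∀ i k l : Fin n, stRiem T τ G F i.succ 0 k.succ l.succ (u, t)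
      = -dUpRic G l i k q + dRicUp G k i l q + ∑ p, riem G i p k l q * grad G F p q) ∧
    (∀ i l : Fin n, stRiem T τ G F i.succ 0 0 l.succ (u, t)
      = dt (timeInterval T) (ricUp G i l) q
        - ∑ p, grad G F p q * dRicUp G p i l q
        - (1 / 2 : ℝ) * hessUp G (scal G) i l q
        - ∑ p, ricUp G i p q * ricUp G p l q
        - ∑ p, (dRicUp G i p l q - dRicUp G p i l q) * grad G F p q
        - ∑ p, (dUpRic G l i p q - dRicUp G p i l q) * grad G F p q
        + ∑ p, ricUp G i p q * hessUp G F p l q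
        - ∑ p, ricUp G p l q * hessUp G F i p q
        + ∑ p, ∑ r, riem G i p r l q * grad G F p q * grad G F r q) ∧
    (∀ i l : Fin n, stRiem T τ G F i.succ 0 0 l.succ (u, t)
      = laplacianMixed G (ricUp G) i l q
        - (1 / 2 : ℝ) * hessUp G (scal G) i l q
        + 2 * ∑ m, ∑ p, ∑ r, ginv G l m q * riem G p i m r q * ricUp G r p q
        - ∑ m, ricUp G m l q * ricUp G i m q
        - ∑ p, ∑ r, ginv G r l q * tensorP G i p r q * grad G F p q
        - ∑ p, ∑ r, ginv G r l q * tensorP G r p i q * grad G F p q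
        + ∑ p, ∑ r, riem G i p r l q * grad G F p q * grad G F r q) := by
  exact stRiem_eq φ.open_target (hflow.smooth_metric φ hφ)
    (fun i j p _ => metricComp_symm g i j p) (fun p hp => det_metricComp_ne_zero g hφ hp.1)
    (contDiffOn_funComp hflow.smooth_potential hφ)
    (fun i j p hp => hflow.flow φ hφ p.1 hp.1 p.2 hp.2 i j) hτ hu ht
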